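/- Fix an integer $N\ge 4$ and reals $\alpha\in\mathbb R$, $0\le x\le 1$. On the space $(\mathbb C^2)^{\otimes N}$ of $N$ qubits consider the state $$\rho_N(x)=x\,|\Psi_G\rangle\langle\Psi_G|+\frac{1-x}{2N}\sum_{k=1}^N\bigl(|u_k\rangle\langle u_k|+|v_k\rangle\langle v_k|\bigr),\qquad |\Psi_G\rangle=\tfrac1{\sqrt2}\bigl(|0\cdots0\rangle+e^{i\alpha}|1\cdots1\rangle\bigr),$$ where $|u_k\rangle$ is the computational basis vector with a $1$ at position $k$ and $0$ elsewhere, and $|v_k\rangle$ the one with a $0$ at position $k$ and $1$ elsewhere (Dür's multipartite states). Logarithms have base $2$. For a state (density matrix) $\rho$ of $N$ parties with finite-dimensional local Hilbert spaces, let $\mathrm{SEP}$ be the set of fully separable states, i.e. of finite convex combinations of products $\sigma^1\otimes\cdots\otimes\sigma^N$ of single-party states. The geometric measure (GM) is $G(\rho)=-2\log\Lambda(\rho)$ with $\Lambda^2(\rho)=\max_{\sigma\in\mathrm{SEP}}\operatorname{tr}(\rho\sigma)$. The relative entropy of entanglement (REE) is $E_R(\rho)=\min_{\sigma\in\mathrm{SEP}}S(\rho\|\sigma)$,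 where $S(\rho\|\sigma)=\operatorname{tr}\rho(\log\rho-\log\sigma)$, understood as $+\infty$ if the support of $\rho$ is not contained in that of $\sigma$. A tensor product $\rho\otimes\sigma$ of two $N$-partite states, or a power $\rho^{\otimes n}$, is regarded as an $N$-partite state whose $j$-th party holds the $j$-th parties of all factors. For $E\in\{G,E_R\}$ put $E^\infty(\rho)=\lim_{n\to\infty}\frac1nE(\rho^{\otimes n})$. $E$ of $\rho$ is called additive if this limit exists and $E^\infty(\rho)=E(\rho)$, and strong additive if $E(\rho\otimes\sigma)=E(\rho)+E(\sigma)$ for every $N$-partite state $\sigma$. **Proposition.** The GM of $\rho_N(x)$ is strong additive and the REE of $\rho_N(x)$ is additive; moreover $$G^\infty[\rho_N(x)]=G[\rho_N(x)]=\begin{cases}-\log\frac{1-x}{2N}, & 0\le x\le\frac1{N+1},\\[2pt] -\log\frac x2, & \frac1{N+1}\le x\le1,\end{cases}\qquad E_R^\infty[\rho_N(x)]=E_R[\rho_N(x)]=x .$$ -/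

import Mathlib

open scoped Topology ComplexOrder

noncomputable section

namespace MultipartiteEntanglement

/-- Density matrices: positive semidefinite with unit trace. -/
def IsState {n : Type} [Fintype n] (ρ : Matrix n n ℂ) : Prop :=
  ρ.PosSemidef ∧ ρ.trace = 1

/-- Operators on `⨂ j, ℂ^(ι j)`, in the computational product basis. -/
abbrev Op {N : ℕ} (ι : Fin N → Type) : Type :=
  Matrix (∀ j, ι j) (∀ j, ι j) ℂ

/-- The product operator `⨂ j, τ j`. -/
def productOp {N : ℕ} {ι : Fin N → Type} (τ : ∀ j, Matrix (ι j) (ι j) ℂ) : Op ι :=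
  Matrix.of fun a b => ∏ j, τ j (a j) (b j)

/-- The fully separable states: finite convex combinations of products of single-party states. -/
def SEP {N : ℕ} (ι : Fin N → Type) [∀ j, Fintype (ι j)] : Set (Op ι) :=
  convexHull ℝ {σ | ∃ τ : ∀ j, Matrix (ι j) (ι j) ℂ, (∀ j, IsState (τ j)) ∧ σ = productOp τ}

/-- The tensor product `ρ ⊗ σ` of two `N`-partite operators, again as an `N`-partite operator:
the `j`-th party of the product holds the `j`-th parties of both factors. -/
def tensor {N : ℕ} {ι κ : Fin N → Type} (ρ : Op ι) (σ : Op κ) : Op (fun j => ι j × κ j) :=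
  Matrix.of fun a b =>
    ρ (fun j => (a j).1) (fun j => (b j).1) * σ (fun j => (a j).2) (fun j => (b j).2)

/-- The `n`-fold tensor power `ρ^{⊗n}` of an `N`-partite operator, again as an `N`-partite
operator: the `j`-th party holds the `j`-th parties of all `n` copies. -/
def tensorPow {N : ℕ} {ι : Fin N → Type} (ρ : Op ι) (n : ℕ) : Op (fun j => Fin n → ι j) :=
  Matrix.of fun a b => ∏ m : Fin n, ρ (fun j => a j m) (fun j => b j m)

/-- The quantum relative entropy `S(ρ‖σ) = tr ρ (log₂ ρ - log₂ σ)` of two states, with the value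
`+∞` when the support of `ρ` is not contained in that of `σ` (i.e. unless `ker σ ⊆ ker ρ`).
The logarithm vanishes on the kernel of its argument, since `Real.logb 2 0 = 0`. -/
def relEntropy {n : Type} [Fintype n] [DecidableEq n] (ρ σ : Matrix n n ℂ) : EReal :=
  open Classical in
  if ∀ v : n → ℂ, σ.mulVec v = 0 → ρ.mulVec v = 0 then
    (((ρ * (cfc (Real.logb 2) ρ - cfc (Real.logb 2) σ)).trace.re : ℝ) : EReal)
  else ⊤

/-- Functionals on operators of `N`-partite systems, for all (finite) local dimensions. -/
abbrev Functional (N : ℕ) : Type 1 :=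
  ∀ (ι : Fin N → Type) [∀ j, Fintype (ι j)] [∀ j, DecidableEq (ι j)], Op ι → EReal

/-- `Λ²(ρ)`, the maximum of `tr (ρ σ)` over fully separable states `σ`. -/
def lambdaSq {N : ℕ} {ι : Fin N → Type} [∀ j, Fintype (ι j)] (ρ : Op ι) : ℝ :=
  sSup ((fun σ : Op ι => (ρ * σ).trace.re) '' SEP ι)

/-- The geometric measure `G(ρ) = -2 log₂ Λ(ρ)`. -/
def GM (N : ℕ) : Functional N :=
  fun _ _ _ ρ => ((-2 * Real.logb 2 (Real.sqrt (lambdaSq ρ)) : ℝ) : EReal)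

/-- The relative entropy of entanglement `E_R(ρ)`, the minimum of `S(ρ‖σ)` over fully separable
states `σ`. -/
def REE (N : ℕ) : Functional N :=
  fun ι _ _ ρ => ⨅ σ ∈ SEP ι, relEntropy ρ σ

/-- `E^∞(ρ) = L`, i.e. the limit of `E(ρ^{⊗n}) / n` exists and equals `L`. -/
def HasRegularization {N : ℕ} (E : Functional N) {ι : Fin N → Type} [∀ j, Fintype (ι j)]
    [∀ j, DecidableEq (ι j)] (ρ : Op ι) (L : EReal) : Prop :=
  Filter.Tendsto (fun n : ℕ => E (fun j => Fin n → ι j) (tensorPow ρ n) / ((n : ℝ) : EReal))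
    Filter.atTop (𝓝 L)

/-- Additivity: `E^∞(ρ) = E(ρ)`. -/
def IsAdditive {N : ℕ} (E : Functional N) {ι : Fin N → Type} [∀ j, Fintype (ι j)]
    [∀ j, DecidableEq (ι j)] (ρ : Op ι) : Prop :=
  HasRegularization E ρ (E ι ρ)

/-- Strong additivity: `E(ρ ⊗ σ) = E(ρ) + E(σ)` for every `N`-partite state `σ`. -/
def IsStrongAdditive {N : ℕ} (E : Functional N) {ι : Fin N → Type} [∀ j, Fintype (ι j)]
    [∀ j, DecidableEq (ι j)] (ρ : Op ι) : Prop :=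
  ∀ (κ : Fin N → Type) [∀ j, Fintype (κ j)] [∀ j, DecidableEq (κ j)] (σ : Op κ), IsState σ →
    E (fun j => ι j × κ j) (tensor ρ σ) = E ι ρ + E κ σ

/-- The operator `|ψ⟩⟨ψ|`. -/
def proj {n : Type} (ψ : n → ℂ) : Matrix n n ℂ :=
  Matrix.vecMulVec ψ (star ψ)

/-- The computational basis vector `|b⟩` of `N` qubits. -/
def ket {N : ℕ} (b : Fin N → Fin 2) : (Fin N → Fin 2) → ℂ :=
  Pi.single b 1

/-- The GHZ vector `(|0…0⟩ + e^{iα} |1…1⟩) / √2`. -/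
def ghz (N : ℕ) (α : ℝ) : (Fin N → Fin 2) → ℂ :=
  (((1 / Real.sqrt 2 : ℝ)) : ℂ) •
    (ket (fun _ => 0) + Complex.exp (α * Complex.I) • ket (fun _ => 1))

/-- `|u_k⟩`: the `k`-th qubit is `1`, all others are `0`. -/
def uVec {N : ℕ} (k : Fin N) : (Fin N → Fin 2) → ℂ :=
  ket (Function.update (fun _ => 0) k 1)

/-- `|v_k⟩`: the `k`-th qubit is `0`, all others are `1`. -/
def vVec {N : ℕ} (k : Fin N) : (Fin N → Fin 2) → ℂ :=
  ket (Function.update (fun _ => 1) k 0)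

/-- The family `ρ_N(x) = x |Ψ_G⟩⟨Ψ_G| + (1 - x)/(2N) ∑ₖ (|u_k⟩⟨u_k| + |v_k⟩⟨v_k|)`. -/
def durState (N : ℕ) (α x : ℝ) : Op (fun _ : Fin N => Fin 2) :=
  (x : ℂ) • proj (ghz N α) +
    (((1 - x) / (2 * N) : ℝ) : ℂ) • ∑ k : Fin N, (proj (uVec k) + proj (vVec k))

end MultipartiteEntanglement

end

/-! Everything rests on bounding the overlap after each matrix entry is replaced by its absolute
value (`AbsProductBound`). If `∑ |ρ a b| C a C b ≤ m` for all nonnegative product unit vectors, then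
`Λ²(ρ ⊗ σ) ≤ m Λ²(σ)`: slice a product vector of the joint system along the basis of the first
factor, and bound the cross terms `⟨φ_a|σ|φ_b⟩` by Cauchy–Schwarz for the positive form `σ`. If
moreover some diagonal entry `ρ a a` equals `m`, the product basis vector `a` gives the reverse
inequality (`lambdaSq_tensor`).

For Dür's states the bound comes from one inequality on product amplitudes
(`prod_amplitudes_bound`): `(C₀ + C₁)² + ∑ₖ (C_{u_k}² + C_{v_k}²) ≤ 1`, where `C₀`, `C₁` belong to
`0…0`, `1…1`. The squares of all amplitudes sum to `1`, and `2 C₀ C₁ = 2 C_p C_q ≤ C_p² + C_q²` for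
a weight-two string `p` and its complement `q`; since `N ≥ 4`, these two strings are not used
elsewhere. Hence `Λ² = max (x/2) ((1-x)/(2N))`.

For the REE, the diagonal part of `ρ` is separable and lies at relative entropy `x`, because
dephasing splits the eigenvalue `x` into two halves. Conversely, the witness `Γ = 2|Ψ⟩⟨Ψ| + ∑ₖ
(|u_k⟩⟨u_k| + |v_k⟩⟨v_k|)` has overlap at most `1` with `SEP`, being `2(N+1)` times the state at `x
= 1/(N+1)`. It is diagonal in the same eigenbasis, so `log t ≤ t - 1` gives `S(ρ‖σ) ≥ tr ρ log Γ =
x` (`le_relEntropy_of_witness`). Witness, diagonal part and overlap bound all pass to tensor powers,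
so `n` copies give `n x`. -/

namespace MultipartiteEntanglement

open Matrix Finset

/-! ### Operators given by a spectral decomposition -/

/-- The operator with eigenvectors the columns of `U` and eigenvalues `d`. -/
noncomputable def spectralOp {n : Type} [Fintype n] [DecidableEq n] (U : Matrix n n ℂ)
    (d : n → ℝ) : Matrix n n ℂ :=
  U * diagonal (fun i => (d i : ℂ)) * Uᴴ

section Spectral

variable {n : Type} [Fintype n] [DecidableEq n]

theorem spectralOp_apply (U : Matrix n n ℂ) (d : n → ℝ) (a b : n) :
    spectralOp U d a b = ∑ i, U a i * (d i : ℂ) * star (U b i) := by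
  simp [spectralOp, Matrix.mul_apply, Matrix.diagonal_apply, Matrix.conjTranspose_apply]

theorem posSemidef_spectralOp (U : Matrix n n ℂ) {d : n → ℝ} (hd : ∀ i, 0 ≤ d i) :
    (spectralOp U d).PosSemidef := by
  have h : (diagonal (fun i => (d i : ℂ))).PosSemidef :=
    Matrix.PosSemidef.diagonal (fun i => by simpa using hd i)
  exact h.mul_mul_conjTranspose_same U

/-- The diagonal entry is `∑ d i |U b i|²`, a sum of nonnegative terms that must all vanish. This
yields the support condition for a state against its diagonal part. -/
theorem spectralOp_apply_eq_zero {U : Matrix n n ℂ} {d : n → ℝ} (hd : ∀ i, 0 ≤ d i) {b : n}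
    (h : spectralOp U d b b = 0) (a : n) : spectralOp U d a b = 0 := by
  have h1 : ∑ i, d i * ‖U b i‖ ^ 2 = 0 := by
    rw [spectralOp_apply] at h
    have : ((∑ i, d i * ‖U b i‖ ^ 2 : ℝ) : ℂ) = 0 := by
      rw [← h]
      push_cast
      refine Finset.sum_congr rfl fun i _ => ?_
      rw [← Complex.mul_conj', RCLike.star_def]
      ring
    exact_mod_cast this
  rw [Finset.sum_eq_zero_iff_of_nonneg fun i _ => mul_nonneg (hd i) (by positivity)] at h1
  rw [spectralOp_apply]
  refine Finset.sum_eq_zero fun i hi => ?_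
  rcases mul_eq_zero.mp (h1 i hi) with h2 | h2
  · simp [h2]
  · have : U b i = 0 := by simpa using h2
    simp [this]

theorem trace_spectralOp {U : Matrix n n ℂ} (hU : Uᴴ * U = 1) (d : n → ℝ) :
    (spectralOp U d).trace = ((∑ i, d i : ℝ) : ℂ) := by
  rw [spectralOp, Matrix.trace_mul_comm, ← Matrix.mul_assoc, hU, Matrix.one_mul,
    Matrix.trace_diagonal]
  push_cast; rfl

theorem spectralOp_mul_spectralOp {U : Matrix n n ℂ} (hU : Uᴴ * U = 1) (d e : n → ℝ) :
    spectralOp U d * spectralOp U e = spectralOp U (fun i => d i * e i) := by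
  have : spectralOp U d * spectralOp U e =
      U * diagonal (fun i => (d i : ℂ)) * (Uᴴ * U) * diagonal (fun i => (e i : ℂ)) * Uᴴ := by
    simp only [spectralOp, Matrix.mul_assoc]
  rw [this, hU, Matrix.mul_one, Matrix.mul_assoc U, Matrix.diagonal_mul_diagonal, spectralOp]
  push_cast; rfl

theorem exists_spectralOp {A : Matrix n n ℂ} (hA : A.IsHermitian) :
    ∃ V : Matrix n n ℂ, Vᴴ * V = 1 ∧ V * Vᴴ = 1 ∧ A = spectralOp V hA.eigenvalues ∧
      ∀ f : ℝ → ℝ, cfc f A = spectralOp V (fun i => f (hA.eigenvalues i)) := by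
  refine ⟨hA.eigenvectorUnitary, ?_, ?_, ?_, ?_⟩
  · exact Unitary.coe_star_mul_self hA.eigenvectorUnitary
  · exact Unitary.coe_mul_star_self hA.eigenvectorUnitary
  · conv_lhs => rw [hA.spectral_theorem, Unitary.conjStarAlgAut_apply]
    rfl
  · intro f
    rw [hA.cfc_eq, Matrix.IsHermitian.cfc, Unitary.conjStarAlgAut_apply]
    rfl

/-- The functional calculus does not depend on the diagonalization: the change of basis `Vᴴ * U`
intertwines the two spectra, so its nonzero entries join equal eigenvalues, and it intertwines their
images under `f` as well. -/
theorem cfc_spectralOp {U : Matrix n n ℂ} (hU : Uᴴ * U = 1) (d : n → ℝ) (f : ℝ → ℝ) :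
    cfc f (spectralOp U d) = spectralOp U (fun i => f (d i)) := by
  have hU' : U * Uᴴ = 1 := mul_eq_one_comm.mp hU
  have hA : (spectralOp U d).IsHermitian := by
    unfold spectralOp
    refine Matrix.isHermitian_mul_mul_conjTranspose U ?_
    simp [Matrix.IsHermitian, Matrix.diagonal_conjTranspose, Pi.star_def]
  obtain ⟨V, hV, hV', hs, hf⟩ := exists_spectralOp hA
  rw [hf]
  generalize hA.eigenvalues = e at hs
  have h1 : diagonal (fun i => (e i : ℂ)) * (Vᴴ * U) =
      (Vᴴ * U) * diagonal (fun i => (d i : ℂ)) := by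
    have := congrArg (fun X => Vᴴ * X * U) hs
    simp only [spectralOp, ← Matrix.mul_assoc] at this
    rw [hV, Matrix.one_mul, Matrix.mul_assoc _ Uᴴ U, hU, Matrix.mul_one] at this
    rw [this, Matrix.mul_assoc]
  have h2 : diagonal (fun i => (f (e i) : ℂ)) * (Vᴴ * U) =
      (Vᴴ * U) * diagonal (fun i => (f (d i) : ℂ)) := by
    ext i j
    have := congrFun (congrFun h1 i) j
    rw [Matrix.diagonal_mul, Matrix.mul_diagonal] at this ⊢
    by_cases h0 : (Vᴴ * U) i j = 0
    · simp [h0]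
    · have h3 : (e i : ℂ) = d j := mul_right_cancel₀ h0 (by rw [this, mul_comm])
      rw [Complex.ofReal_inj.mp h3, mul_comm]
  calc V * diagonal (fun i => (f (e i) : ℂ)) * Vᴴ
      = V * (diagonal (fun i => (f (e i) : ℂ)) * (Vᴴ * U)) * Uᴴ := by
        simp only [Matrix.mul_assoc, hU', Matrix.mul_one]
    _ = V * Vᴴ * U * diagonal (fun i => (f (d i) : ℂ)) * Uᴴ := by
        rw [h2]; simp only [Matrix.mul_assoc]
    _ = _ := by rw [hV', Matrix.one_mul]; rfl

theorem diagonal_eq_spectralOp (d : n → ℝ) :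
    diagonal (fun i => (d i : ℂ)) = spectralOp 1 d := by
  simp [spectralOp]

theorem spectralOp_mulVec_col {V : Matrix n n ℂ} (hV : Vᴴ * V = 1) (s : n → ℝ) (k : n) :
    (spectralOp V s).mulVec (fun a => V a k) = (s k : ℂ) • fun a => V a k := by
  have : (fun a => V a k) = V.mulVec (Pi.single k 1) := by ext a; simp
  rw [this, spectralOp, Matrix.mulVec_mulVec, Matrix.mul_assoc, hV, Matrix.mul_one,
    ← Matrix.mulVec_mulVec, ← Matrix.mulVec_smul]
  congr 1
  ext i
  simp only [Matrix.mulVec_diagonal, Pi.single_apply, Pi.smul_apply, smul_eq_mul]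
  split_ifs with h
  · rw [h]
  · simp

theorem trace_spectralOp_mul_spectralOp (U V : Matrix n n ℂ) (d s : n → ℝ) :
    (spectralOp U d * spectralOp V s).trace =
      ((∑ i, ∑ k, d i * s k * ‖(Vᴴ * U) k i‖ ^ 2 : ℝ) : ℂ) := by
  have h : (spectralOp U d * spectralOp V s).trace =
      (diagonal (fun i => (d i : ℂ)) * (Vᴴ * U)ᴴ * diagonal (fun i => (s i : ℂ)) *
        (Vᴴ * U)).trace := by
    rw [Matrix.conjTranspose_mul, Matrix.conjTranspose_conjTranspose, spectralOp, spectralOp,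
      Matrix.mul_assoc U, Matrix.mul_assoc U, Matrix.trace_mul_comm]
    simp only [Matrix.mul_assoc]
  rw [h, Matrix.trace]
  push_cast
  refine Finset.sum_congr rfl fun i _ => ?_
  rw [Matrix.diag_apply, Matrix.mul_apply]
  refine Finset.sum_congr rfl fun k _ => ?_
  rw [Matrix.mul_diagonal, Matrix.diagonal_mul, Matrix.conjTranspose_apply,
    ← Complex.mul_conj']
  simp only [RCLike.star_def]
  ring

theorem sum_norm_sq_row {W : Matrix n n ℂ} (hW : Wᴴ * W = 1) (i : n) :
    ∑ k, ‖W k i‖ ^ 2 = 1 := by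
  have h := congrFun (congrFun hW i) i
  rw [Matrix.mul_apply, Matrix.one_apply_eq] at h
  have h2 : ((∑ k, ‖W k i‖ ^ 2 : ℝ) : ℂ) = 1 := by
    rw [← h]
    push_cast
    refine Finset.sum_congr rfl fun k _ => ?_
    rw [Matrix.conjTranspose_apply, RCLike.star_def, Complex.conj_mul']
  exact_mod_cast h2

/-! ### Bounds for the relative entropy -/

/-- A positive witness `∑ᵢ wᵢ |uᵢ⟩⟨uᵢ|`, diagonal in an eigenbasis of `ρ`, bounds the relative
entropy from below. -/
theorem le_relEntropy_of_witness {U : Matrix n n ℂ} (hU : Uᴴ * U = 1) {p w : n → ℝ}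
    (hp : ∀ i, 0 ≤ p i) (hp1 : ∑ i, p i = 1) (hw : ∀ i, 0 ≤ w i)
    (hpw : ∀ i, p i ≠ 0 → w i ≠ 0) {σ : Matrix n n ℂ} (hσ : σ.PosSemidef)
    (htr : (spectralOp U w * σ).trace.re ≤ 1) :
    ((∑ i, p i * Real.logb 2 (w i) : ℝ) : EReal) ≤ relEntropy (spectralOp U p) σ := by
  classical
  unfold relEntropy
  split_ifs with hsupp
  swap
  · exact le_top
  obtain ⟨V, hV, hV', hs, hf⟩ := exists_spectralOp hσ.isHermitian
  have hs0 : ∀ k, 0 ≤ hσ.isHermitian.eigenvalues k := hσ.eigenvalues_nonneg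
  rw [cfc_spectralOp hU, hf]
  generalize hσ.isHermitian.eigenvalues = s at hs hs0
  subst hs
  set W := Vᴴ * U with hWdef
  have hW : Wᴴ * W = 1 := by
    rw [hWdef, Matrix.conjTranspose_mul, Matrix.conjTranspose_conjTranspose, Matrix.mul_assoc,
      ← Matrix.mul_assoc V, hV', Matrix.one_mul, hU]
  have hT : ∀ i, ∑ k, ‖W k i‖ ^ 2 = 1 := sum_norm_sq_row hW
  -- Support inclusion in coordinates: a null eigenvector of `σ` is orthogonal to every eigenvector
  -- of `ρ` with nonzero eigenvalue.
  have hker : ∀ i k, p i ≠ 0 → s k = 0 → W k i = 0 := by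
    intro i k hpi hsk
    have h1 := hsupp (fun a => V a k) (by rw [spectralOp_mulVec_col hV, hsk]; simp)
    have h2 : (Uᴴ * spectralOp U p).mulVec (fun a => V a k) i = 0 := by
      rw [← Matrix.mulVec_mulVec, h1]; simp
    rw [spectralOp, ← Matrix.mul_assoc, ← Matrix.mul_assoc, hU, Matrix.one_mul,
      ← Matrix.mulVec_mulVec, Matrix.mulVec_diagonal] at h2
    have h3 : (Uᴴ.mulVec fun a => V a k) i = 0 := by
      rcases mul_eq_zero.mp h2 with h | h
      · exact absurd (by exact_mod_cast h) hpi
      · exact h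
    have h4 : (Uᴴ.mulVec fun a => V a k) i = star (W k i) := by
      rw [hWdef, ← Matrix.conjTranspose_apply, Matrix.conjTranspose_mul,
        Matrix.conjTranspose_conjTranspose]
      rfl
    rw [h4] at h3
    exact star_eq_zero.mp h3
  rw [trace_spectralOp_mul_spectralOp, Complex.ofReal_re] at htr
  rw [Matrix.mul_sub, Matrix.trace_sub, spectralOp_mul_spectralOp hU, trace_spectralOp hU,
    trace_spectralOp_mul_spectralOp, ← Complex.ofReal_sub, Complex.ofReal_re]
  norm_cast
  have hlog2 : 0 < Real.log 2 := Real.log_pos (by norm_num)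
  -- This is `log t ≤ t - 1` at `t = w i * s k / p i`. Summed, the right side becomes `(tr Γσ - 1) /
  -- log 2 ≤ 0`, where `Γ` is the witness.
  have hterm : ∀ i k, ‖W k i‖ ^ 2 * (p i * (Real.logb 2 (w i) + Real.logb 2 (s k)
      - Real.logb 2 (p i))) ≤ ‖W k i‖ ^ 2 * ((w i * s k - p i) / Real.log 2) := by
    intro i k
    by_cases hWk : W k i = 0
    · simp [hWk]
    refine mul_le_mul_of_nonneg_left ?_ (by positivity)
    by_cases hpi : p i = 0
    · rw [hpi]
      have := mul_nonneg (hw i) (hs0 k)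
      simp only [zero_mul, sub_zero]
      positivity
    have hsk : s k ≠ 0 := fun h => hWk (hker i k hpi h)
    have hwi := hpw i hpi
    have hpos : 0 < w i * s k / p i :=
      div_pos (mul_pos (lt_of_le_of_ne (hw i) hwi.symm) (lt_of_le_of_ne (hs0 k) hsk.symm))
        (lt_of_le_of_ne (hp i) (Ne.symm hpi))
    have h := Real.log_le_sub_one_of_pos hpos
    rw [← Real.logb_mul hwi hsk, ← Real.logb_div (mul_ne_zero hwi hsk) hpi, Real.logb,
      ← mul_div_assoc]
    gcongr
    calc p i * Real.log (w i * s k / p i) ≤ p i * (w i * s k / p i - 1) :=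
          mul_le_mul_of_nonneg_left h (hp i)
      _ = w i * s k - p i := by field_simp
  have hsum := Finset.sum_le_sum fun i (_ : i ∈ univ) =>
    Finset.sum_le_sum fun k (_ : k ∈ univ) => hterm i k
  have hL : ∑ i, ∑ k, ‖W k i‖ ^ 2 * (p i * (Real.logb 2 (w i) + Real.logb 2 (s k)
      - Real.logb 2 (p i))) = ∑ i, p i * Real.logb 2 (w i) +
      ∑ i, ∑ k, p i * Real.logb 2 (s k) * ‖W k i‖ ^ 2 - ∑ i, p i * Real.logb 2 (p i) := by
    rw [← Finset.sum_add_distrib, ← Finset.sum_sub_distrib]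
    refine Finset.sum_congr rfl fun i _ => ?_
    have : p i * Real.logb 2 (w i) - p i * Real.logb 2 (p i) = ∑ k, ‖W k i‖ ^ 2 *
        (p i * Real.logb 2 (w i) - p i * Real.logb 2 (p i)) := by
      rw [← Finset.sum_mul, hT, one_mul]
    rw [add_sub_right_comm, this, ← Finset.sum_add_distrib]
    exact Finset.sum_congr rfl fun k _ => by ring
  have hR : ∑ i, ∑ k, ‖W k i‖ ^ 2 * ((w i * s k - p i) / Real.log 2) =
      (∑ i, ∑ k, w i * s k * ‖W k i‖ ^ 2 - 1) / Real.log 2 := by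
    rw [← hp1, ← Finset.sum_sub_distrib, Finset.sum_div]
    refine Finset.sum_congr rfl fun i _ => ?_
    have : p i = ∑ k, ‖W k i‖ ^ 2 * p i := by rw [← Finset.sum_mul, hT, one_mul]
    conv_rhs => rw [this]
    rw [← Finset.sum_sub_distrib, Finset.sum_div]
    exact Finset.sum_congr rfl fun k _ => by ring
  rw [hL, hR] at hsum
  have : (∑ i, ∑ k, w i * s k * ‖W k i‖ ^ 2 - 1) / Real.log 2 ≤ 0 :=
    div_nonpos_of_nonpos_of_nonneg (by linarith) hlog2.le
  linarith

/-- The relative entropy of `ρ` with respect to its own diagonal part. -/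
theorem relEntropy_diagonal {U : Matrix n n ℂ} (hU : Uᴴ * U = 1) {p δ : n → ℝ}
    (hp : ∀ i, 0 ≤ p i) (hδ : ∀ a, spectralOp U p a a = (δ a : ℂ)) :
    relEntropy (spectralOp U p) (diagonal fun a => (δ a : ℂ)) =
      ((∑ i, p i * Real.logb 2 (p i) - ∑ a, δ a * Real.logb 2 (δ a) : ℝ) : EReal) := by
  classical
  unfold relEntropy
  rw [if_pos]
  swap
  · intro v hv
    ext a
    rw [Matrix.mulVec, dotProduct, Pi.zero_apply]
    refine Finset.sum_eq_zero fun b _ => ?_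
    -- Where `δ b = 0`, column `b` of the state vanishes; elsewhere `v b = 0`.
    by_cases h : spectralOp U p a b = 0
    · rw [h, zero_mul]
    · have := congrFun hv b
      rw [Matrix.mulVec_diagonal, Pi.zero_apply] at this
      rcases mul_eq_zero.mp this with h' | h'
      · exact absurd (spectralOp_apply_eq_zero hp ((hδ b).trans h') a) h
      · rw [h', mul_zero]
  have hdiag : cfc (Real.logb 2) (diagonal fun a => (δ a : ℂ)) =
      diagonal fun a => (Real.logb 2 (δ a) : ℂ) := by
    rw [diagonal_eq_spectralOp, cfc_spectralOp (by simp), ← diagonal_eq_spectralOp]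
  rw [cfc_spectralOp hU, hdiag, Matrix.mul_sub, Matrix.trace_sub, spectralOp_mul_spectralOp hU,
    trace_spectralOp hU]
  have : (spectralOp U p * diagonal fun a => (Real.logb 2 (δ a) : ℂ)).trace =
      ((∑ a, δ a * Real.logb 2 (δ a) : ℝ) : ℂ) := by
    rw [Matrix.trace]
    push_cast
    exact Finset.sum_congr rfl fun a _ => by rw [Matrix.diag_apply, Matrix.mul_diagonal, hδ]
  rw [this, ← Complex.ofReal_sub, Complex.ofReal_re]

end Spectral

/-! ### Product vectors and the maximal overlap with separable states -/

/-- The product vector `⨂ j, ψ j`. -/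
def prodVec {N : ℕ} {ι : Fin N → Type} (ψ : ∀ j, ι j → ℂ) : (∀ j, ι j) → ℂ := fun a => ∏ j, ψ j (a j)

theorem productOp_proj {N : ℕ} {ι : Fin N → Type} (ψ : ∀ j, ι j → ℂ) :
    productOp (fun j => proj (ψ j)) = proj (prodVec ψ) := by
  ext a b
  simp [productOp, proj, prodVec, Matrix.vecMulVec_apply, Finset.prod_mul_distrib]

section Product

variable {N : ℕ} {ι κ : Fin N → Type} [∀ j, Fintype (ι j)] [∀ j, Fintype (κ j)]

/-- `⟨ψ|M|ψ⟩ ≤ L` for all product unit vectors `ψ`. -/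
def ProductBound (M : Op ι) (L : ℝ) : Prop :=
  ∀ ψ : ∀ j, ι j → ℂ, (∀ j, ∑ i, ‖ψ j i‖ ^ 2 = 1) →
    (star (prodVec ψ) ⬝ᵥ M.mulVec (prodVec ψ)).re ≤ L

theorem trace_mul_proj {n : Type} [Fintype n] (M : Matrix n n ℂ) (v : n → ℂ) :
    (M * proj v).trace = star v ⬝ᵥ M.mulVec v := by
  rw [proj, Matrix.mul_vecMulVec, Matrix.trace_vecMulVec, dotProduct_comm]

theorem isState_proj {n : Type} [Fintype n] {v : n → ℂ} (hv : ∑ i, ‖v i‖ ^ 2 = 1) :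
    IsState (proj v) := by
  refine ⟨Matrix.posSemidef_vecMulVec_self_star v, ?_⟩
  rw [proj, Matrix.trace_vecMulVec, dotProduct]
  simp only [Pi.star_apply, RCLike.star_def, Complex.mul_conj']
  exact_mod_cast hv

theorem IsState.exists_mixture {n : Type} [Fintype n] {τ : Matrix n n ℂ} (h : IsState τ) :
    ∃ (t : n → ℝ) (v : n → n → ℂ), (∀ k, 0 ≤ t k) ∧ ∑ k, t k = 1 ∧
      (∀ k, ∑ i, ‖v k i‖ ^ 2 = 1) ∧ ∀ a b, τ a b = ∑ k, (t k : ℂ) * proj (v k) a b := by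
  classical
  obtain ⟨V, hV, -, hs, -⟩ := exists_spectralOp h.1.isHermitian
  refine ⟨h.1.isHermitian.eigenvalues, fun k a => V a k, h.1.eigenvalues_nonneg, ?_,
    sum_norm_sq_row hV, fun a b => ?_⟩
  · have := h.2
    rw [hs, trace_spectralOp hV] at this
    exact_mod_cast this
  · conv_lhs => rw [hs, spectralOp_apply]
    refine Finset.sum_congr rfl fun k _ => ?_
    rw [proj, Matrix.vecMulVec_apply, Pi.star_apply]
    ring

theorem productOp_eq_sum {τ : ∀ j, Matrix (ι j) (ι j) ℂ} {t : ∀ j, ι j → ℝ}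
    {v : ∀ j, ι j → ι j → ℂ}
    (h : ∀ j a b, τ j a b = ∑ k, (t j k : ℂ) * proj (v j k) a b) :
    productOp τ = ∑ k : ∀ j, ι j, ((∏ j, t j (k j) : ℝ) : ℂ) •
      proj (prodVec fun j => v j (k j)) := by
  ext a b
  simp only [productOp, Matrix.of_apply, h, Finset.prod_univ_sum, Fintype.piFinset_univ,
    Matrix.sum_apply, Matrix.smul_apply, ← productOp_proj, Finset.prod_mul_distrib, smul_eq_mul,
    Complex.ofReal_prod]

/-- Diagonalizing each local state makes the product a mixture of pure product states, so pure ones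
suffice. -/
theorem ProductBound.re_trace_mul_productOp_le {M : Op ι} {L : ℝ} (hM : ProductBound M L)
    {τ : ∀ j, Matrix (ι j) (ι j) ℂ} (hτ : ∀ j, IsState (τ j)) :
    (M * productOp τ).trace.re ≤ L := by
  choose t v ht ht1 hv hτv using fun j => (hτ j).exists_mixture
  have h := productOp_eq_sum hτv
  rw [h, Matrix.mul_sum, Matrix.trace_sum, Complex.re_sum]
  calc ∑ k : ∀ j, ι j, (M * ((∏ j, t j (k j) : ℝ) : ℂ) •
        proj (prodVec fun j => v j (k j))).trace.re
      ≤ ∑ k : ∀ j, ι j, (∏ j, t j (k j)) * L := by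
        refine Finset.sum_le_sum fun k _ => ?_
        rw [Matrix.mul_smul, Matrix.trace_smul, trace_mul_proj, smul_eq_mul,
          Complex.re_ofReal_mul]
        exact mul_le_mul_of_nonneg_left (hM _ fun j => hv j _)
          (Finset.prod_nonneg fun j _ => ht j _)
    _ = L := by
        rw [← Finset.sum_mul]
        have := Finset.prod_univ_sum (fun j => (univ : Finset (ι j))) (fun j k => t j k)
        rw [Fintype.piFinset_univ] at this
        rw [← this, Finset.prod_eq_one fun j _ => ht1 j, one_mul]

theorem ProductBound.re_trace_mul_le {M : Op ι} {L : ℝ} (hM : ProductBound M L) {σ : Op ι}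
    (hσ : σ ∈ SEP ι) : (M * σ).trace.re ≤ L := by
  have hconv : Convex ℝ {σ : Op ι | (M * σ).trace.re ≤ L} := by
    refine convex_halfSpace_le (f := fun σ : Op ι => (M * σ).trace.re) ⟨?_, ?_⟩ L
    · intro x y; simp [Matrix.mul_add]
    · intro c x; simp
  refine convexHull_min ?_ hconv hσ
  rintro _ ⟨τ, hτ, rfl⟩
  exact hM.re_trace_mul_productOp_le hτ

theorem proj_prodVec_mem_SEP {ψ : ∀ j, ι j → ℂ} (hψ : ∀ j, ∑ i, ‖ψ j i‖ ^ 2 = 1) :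
    proj (prodVec ψ) ∈ SEP ι :=
  subset_convexHull ℝ _ ⟨_, fun j => isState_proj (hψ j), (productOp_proj ψ).symm⟩

theorem posSemidef_productOp {τ : ∀ j, Matrix (ι j) (ι j) ℂ} (hτ : ∀ j, IsState (τ j)) :
    (productOp τ).PosSemidef := by
  choose t v ht ht1 hv hτv using fun j => (hτ j).exists_mixture
  have h := productOp_eq_sum hτv
  rw [h]
  refine Matrix.posSemidef_sum _ fun k _ => ?_
  refine (Matrix.posSemidef_vecMulVec_self_star _).smul ?_
  exact_mod_cast Finset.prod_nonneg fun j _ => ht j _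

theorem posSemidef_of_mem_SEP {σ : Op ι} (hσ : σ ∈ SEP ι) : σ.PosSemidef := by
  have hconv : Convex ℝ {σ : Op ι | σ.PosSemidef} := by
    intro x hx y hy a b ha hb _
    have hx' : (a • x).PosSemidef := Matrix.PosSemidef.smul hx ha
    have hy' : (b • y).PosSemidef := Matrix.PosSemidef.smul hy hb
    exact hx'.add hy'
  refine convexHull_min ?_ hconv hσ
  rintro _ ⟨τ, hτ, rfl⟩
  exact posSemidef_productOp hτ

theorem norm_le_one_of_sum_sq {n : Type} [Fintype n] {v : n → ℂ} (hv : ∑ i, ‖v i‖ ^ 2 = 1)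
    (i : n) : ‖v i‖ ≤ 1 := by
  have : ‖v i‖ ^ 2 ≤ 1 := hv ▸ Finset.single_le_sum (f := fun i => ‖v i‖ ^ 2)
    (fun _ _ => by positivity) (mem_univ i)
  exact (sq_le_one_iff₀ (norm_nonneg _)).mp this

theorem exists_productBound (M : Op ι) : ∃ L, ProductBound M L := by
  refine ⟨∑ a, ∑ b, ‖M a b‖, fun ψ hψ => ?_⟩
  have h1 : ∀ a, ‖prodVec ψ a‖ ≤ 1 := fun a => by
    rw [prodVec, norm_prod]
    exact Finset.prod_le_one (fun _ _ => norm_nonneg _)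
      fun j _ => norm_le_one_of_sum_sq (hψ j) _
  refine (Complex.re_le_norm _).trans ?_
  refine (norm_sum_le _ _).trans (Finset.sum_le_sum fun a _ => ?_)
  rw [norm_mul, Pi.star_apply, norm_star]
  refine (mul_le_of_le_one_left (norm_nonneg _) (h1 a)).trans ?_
  refine (norm_sum_le _ _).trans (Finset.sum_le_sum fun b _ => ?_)
  rw [norm_mul]
  exact mul_le_of_le_one_right (norm_nonneg _) (h1 b)

theorem exists_unit_vector (n : Type) [Fintype n] [Nonempty n] :
    ∃ v : n → ℂ, ∑ i, ‖v i‖ ^ 2 = 1 := by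
  classical
  obtain ⟨a⟩ := ‹Nonempty n›
  refine ⟨Pi.single a 1, ?_⟩
  rw [Finset.sum_eq_single a] <;> simp +contextual

theorem SEP_nonempty [∀ j, Nonempty (ι j)] : (SEP ι).Nonempty := by
  choose ψ hψ using fun j => exists_unit_vector (ι j)
  exact ⟨_, proj_prodVec_mem_SEP hψ⟩

theorem lambdaSq_le_iff [∀ j, Nonempty (ι j)] {M : Op ι} {L : ℝ} :
    lambdaSq M ≤ L ↔ ProductBound M L := by
  constructor
  · intro h ψ hψ
    rw [← trace_mul_proj]
    refine le_trans (le_csSup ?_ (Set.mem_image_of_mem (fun σ : Op ι => (M * σ).trace.re)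
      (proj_prodVec_mem_SEP hψ))) h
    obtain ⟨B, hB⟩ := exists_productBound M
    refine ⟨B, ?_⟩
    rintro _ ⟨σ, hσ, rfl⟩
    exact hB.re_trace_mul_le hσ
  · intro h
    refine csSup_le (SEP_nonempty.image _) ?_
    rintro _ ⟨σ, hσ, rfl⟩
    exact h.re_trace_mul_le hσ

theorem ProductBound.re_apply_self_le {M : Op ι} {L : ℝ} (h : ProductBound M L)
    (a : ∀ j, ι j) : (M a a).re ≤ L := by
  classical
  have := h (fun j => Pi.single (a j) 1) fun j => by
    rw [Finset.sum_eq_single (a j)] <;> simp +contextual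
  have hv : prodVec (fun j => (Pi.single (a j) 1 : ι j → ℂ)) = Pi.single a 1 := by
    ext b
    simp only [prodVec, Pi.single_apply, Finset.prod_ite_zero, Finset.prod_const_one, mem_univ,
      forall_const, funext_iff]
  rw [hv] at this
  simpa [← Pi.single_star] using this

theorem IsState.nonempty {σ : Op κ} (hσ : IsState σ) : ∀ j, Nonempty (κ j) := by
  intro j
  by_contra h
  rw [not_nonempty_iff] at h
  have : IsEmpty (∀ j, κ j) := ⟨fun a => h.elim (a j)⟩
  have := hσ.2
  simp [Matrix.trace] at this

/-- Otherwise every diagonal entry would be nonpositive, against unit trace. Positivity is what lets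
the logarithm of a product split. -/
theorem IsState.lambdaSq_pos {σ : Op κ} (hσ : IsState σ) : 0 < lambdaSq σ := by
  have := hσ.nonempty
  have hb : ProductBound σ (lambdaSq σ) := lambdaSq_le_iff.mp le_rfl
  by_contra! h
  have h1 := congrArg Complex.re hσ.2
  rw [Matrix.trace, Complex.re_sum, Complex.one_re] at h1
  have : ∑ a, (σ.diag a).re ≤ 0 :=
    Finset.sum_nonpos fun a _ => (hb.re_apply_self_le a).trans h
  linarith

/-! ### Multiplicativity of the maximal overlap -/

/-- The maximum over product unit vectors `c` of `∑ |M a b| |c a| |c b|` is at most `L`. -/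
def AbsProductBound (M : Op ι) (L : ℝ) : Prop :=
  ∀ c : ∀ j, ι j → ℝ, (∀ j i, 0 ≤ c j i) → (∀ j, ∑ i, c j i ^ 2 = 1) →
    ∑ a, ∑ b, ‖M a b‖ * (∏ j, c j (a j)) * (∏ j, c j (b j)) ≤ L

theorem exists_smul_unit {n : Type} [Fintype n] [Nonempty n] (v : n → ℂ) :
    ∃ u : n → ℂ, ∑ i, ‖u i‖ ^ 2 = 1 ∧ ∀ i, v i = (√(∑ i, ‖v i‖ ^ 2) : ℂ) * u i := by
  by_cases h : ∑ i, ‖v i‖ ^ 2 = 0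
  · obtain ⟨u, hu⟩ := exists_unit_vector n
    refine ⟨u, hu, fun i => ?_⟩
    rw [Finset.sum_eq_zero_iff_of_nonneg fun _ _ => by positivity] at h
    have h0 : v i = 0 := by simpa using h i (mem_univ i)
    have h' : ∑ i, ‖v i‖ ^ 2 = 0 := Finset.sum_eq_zero h
    rw [h0, h']; simp
  · have hpos : 0 < ∑ i, ‖v i‖ ^ 2 :=
      lt_of_le_of_ne (Finset.sum_nonneg fun _ _ => by positivity) (Ne.symm h)
    have hr : √(∑ i, ‖v i‖ ^ 2) ≠ 0 := (Real.sqrt_pos.mpr hpos).ne'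
    refine ⟨fun i => v i / (√(∑ i, ‖v i‖ ^ 2) : ℂ), ?_, fun i => ?_⟩
    · simp only [norm_div, Complex.norm_real, div_pow, Real.norm_eq_abs, sq_abs,
        Real.sq_sqrt hpos.le]
      rw [← Finset.sum_div, div_self h]
    · have : (√(∑ i, ‖v i‖ ^ 2) : ℂ) ≠ 0 := by exact_mod_cast hr
      field_simp

/-- Homogeneous form of the bound, needed because slices of a unit vector are not normalized and may
vanish. -/
theorem ProductBound.re_le_mul_prod [∀ j, Nonempty (κ j)] {σ : Op κ} {L : ℝ}
    (h : ProductBound σ L) (ψ : ∀ j, κ j → ℂ) :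
    (star (prodVec ψ) ⬝ᵥ σ.mulVec (prodVec ψ)).re ≤
      L * (∏ j, √(∑ i, ‖ψ j i‖ ^ 2)) ^ 2 := by
  choose u hu hψ using fun j => exists_smul_unit (ψ j)
  set r := ∏ j, √(∑ i, ‖ψ j i‖ ^ 2)
  have hv : prodVec ψ = (r : ℂ) • prodVec u := by
    ext a
    simp only [prodVec, Pi.smul_apply, smul_eq_mul, r, Complex.ofReal_prod,
      ← Finset.prod_mul_distrib]
    exact Finset.prod_congr rfl fun j _ => hψ j _
  rw [hv, star_smul, Matrix.mulVec_smul, smul_dotProduct, dotProduct_smul, smul_smul,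
    RCLike.star_def, Complex.conj_ofReal, smul_eq_mul, ← Complex.ofReal_mul,
    Complex.re_ofReal_mul, ← pow_two, mul_comm]
  exact mul_le_mul_of_nonneg_right (h u hu) (by positivity)

/-- Cauchy–Schwarz for the form of `σ`, through a factorization `σ = Bᴴ * B`. -/
theorem norm_dotProduct_mulVec_le {n : Type} [Fintype n] {σ : Matrix n n ℂ}
    (hσ : σ.PosSemidef) {v w : n → ℂ} {s t : ℝ} (hs : 0 ≤ s) (ht : 0 ≤ t)
    (hv : (star v ⬝ᵥ σ.mulVec v).re ≤ s ^ 2) (hw : (star w ⬝ᵥ σ.mulVec w).re ≤ t ^ 2) :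
    ‖star v ⬝ᵥ σ.mulVec w‖ ≤ s * t := by
  classical
  obtain ⟨B, rfl⟩ : ∃ B : Matrix n n ℂ, σ = Bᴴ * B := by
    open scoped MatrixOrder in
    obtain ⟨B, hB⟩ := CStarAlgebra.nonneg_iff_eq_star_mul_self.mp hσ.nonneg
    exact ⟨B, hB⟩
  have key : ∀ x y : n → ℂ, star x ⬝ᵥ (Bᴴ * B).mulVec y =
      inner ℂ (WithLp.toLp 2 (B.mulVec x)) (WithLp.toLp 2 (B.mulVec y)) := by
    intro x y
    rw [EuclideanSpace.inner_eq_star_dotProduct, ← Matrix.mulVec_mulVec,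
      Matrix.dotProduct_mulVec, dotProduct_comm, Matrix.star_mulVec]
  have hb : ∀ (x : n → ℂ) (r : ℝ), 0 ≤ r → (star x ⬝ᵥ (Bᴴ * B).mulVec x).re ≤ r ^ 2 →
      ‖WithLp.toLp 2 (B.mulVec x)‖ ≤ r := by
    intro x r hr hx
    rw [key] at hx
    have := inner_self_eq_norm_sq (𝕜 := ℂ) (WithLp.toLp 2 (B.mulVec x))
    rw [RCLike.re_eq_complex_re] at this
    rw [this] at hx
    exact le_of_sq_le_sq hx hr
  rw [key]
  exact (norm_inner_le_norm _ _).trans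
    (mul_le_mul (hb v s hs hv) (hb w t ht hw) (norm_nonneg _) hs)

/-- The functions on `∀ j, ι j × κ j` as pairs of functions. -/
def piProdEquiv (ι κ : Fin N → Type) : (∀ j, ι j × κ j) ≃ (∀ j, ι j) × (∀ j, κ j) where
  toFun a := (fun j => (a j).1, fun j => (a j).2)
  invFun a := fun j => (a.1 j, a.2 j)
  left_inv _ := rfl
  right_inv _ := rfl

theorem dotProduct_tensor_mulVec (ρ : Op ι) (σ : Op κ) (φ : ∀ j, ι j × κ j → ℂ) :
    star (prodVec φ) ⬝ᵥ (tensor ρ σ).mulVec (prodVec φ) =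
      ∑ a : ∀ j, ι j, ∑ b : ∀ j, ι j, ρ a b *
        (star (prodVec fun j k => φ j (a j, k)) ⬝ᵥ
          σ.mulVec (prodVec fun j k => φ j (b j, k))) := by
  simp only [dotProduct, Matrix.mulVec]
  rw [← (piProdEquiv ι κ).symm.sum_comp, Fintype.sum_prod_type]
  refine Finset.sum_congr rfl fun a _ => ?_
  simp only [Finset.mul_sum]
  conv_rhs => rw [Finset.sum_comm]
  refine Finset.sum_congr rfl fun a' _ => ?_
  rw [← (piProdEquiv ι κ).symm.sum_comp, Fintype.sum_prod_type]
  refine Finset.sum_congr rfl fun b _ => Finset.sum_congr rfl fun b' _ => ?_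
  simp only [piProdEquiv, Equiv.coe_fn_symm_mk, tensor, Matrix.of_apply, prodVec, Pi.star_apply]
  ring

/-- The norms `c j i` of the local slices `φ j (i, ·)` form nonnegative local unit vectors, and each
cross term is at most `L` times the two products of slice norms. Its phase is unknown, which is why
`ρ` must be controlled in absolute value. -/
theorem AbsProductBound.productBound_tensor [∀ j, Nonempty (κ j)] {ρ : Op ι} {σ : Op κ} {l L : ℝ}
    (hρ : AbsProductBound ρ l) (hσ : σ.PosSemidef) (hL : 0 ≤ L) (h : ProductBound σ L) :
    ProductBound (tensor ρ σ) (l * L) := by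
  intro φ hφ
  let c : ∀ j, ι j → ℝ := fun j i => √(∑ k, ‖φ j (i, k)‖ ^ 2)
  have hc0 : ∀ j i, 0 ≤ c j i := fun j i => Real.sqrt_nonneg _
  have hc : ∀ j, ∑ i, c j i ^ 2 = 1 := fun j => by
    rw [← hφ j, Fintype.sum_prod_type]
    exact Finset.sum_congr rfl fun i _ =>
      Real.sq_sqrt (Finset.sum_nonneg fun _ _ => by positivity)
  have hC : ∀ a : ∀ j, ι j, 0 ≤ ∏ j, c j (a j) := fun a => Finset.prod_nonneg fun j _ => hc0 _ _
  have hq : ∀ a : ∀ j, ι j, (star (prodVec fun j k => φ j (a j, k)) ⬝ᵥ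
      σ.mulVec (prodVec fun j k => φ j (a j, k))).re ≤ (√L * ∏ j, c j (a j)) ^ 2 := fun a => by
    rw [mul_pow, Real.sq_sqrt hL]
    exact h.re_le_mul_prod _
  rw [dotProduct_tensor_mulVec]
  refine (Complex.re_le_norm _).trans ?_
  calc ‖∑ a : ∀ j, ι j, ∑ b : ∀ j, ι j, ρ a b *
        (star (prodVec fun j k => φ j (a j, k)) ⬝ᵥ
          σ.mulVec (prodVec fun j k => φ j (b j, k)))‖
      ≤ ∑ a : ∀ j, ι j, ∑ b : ∀ j, ι j, ‖ρ a b‖ * ((√L * ∏ j, c j (a j)) * (√L * ∏ j, c j (b j))) := by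
        refine norm_sum_le_of_le _ fun a _ => norm_sum_le_of_le _ fun b _ => ?_
        rw [norm_mul]
        exact mul_le_mul_of_nonneg_left (norm_dotProduct_mulVec_le hσ
          (mul_nonneg (Real.sqrt_nonneg _) (hC a)) (mul_nonneg (Real.sqrt_nonneg _) (hC b))
          (hq a) (hq b)) (norm_nonneg _)
    _ = L * ∑ a, ∑ b, ‖ρ a b‖ * (∏ j, c j (a j)) * (∏ j, c j (b j)) := by
        simp only [Finset.mul_sum]
        refine Finset.sum_congr rfl fun a _ => Finset.sum_congr rfl fun b _ => ?_
        conv_rhs => rw [← Real.mul_self_sqrt hL]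
        ring
    _ ≤ l * L := by
        rw [mul_comm l]
        exact mul_le_mul_of_nonneg_left (hρ c hc0 hc) hL

/-- Test on `|a⟩ ⊗ ψ`: only the entry `ρ a a` survives. -/
theorem ProductBound.of_tensor {ρ : Op ι} {σ : Op κ} {L m : ℝ}
    (h : ProductBound (tensor ρ σ) L) (hm : 0 < m) {a : ∀ j, ι j} (ha : ρ a a = m) :
    ProductBound σ (L / m) := by
  classical
  intro ψ hψ
  rw [le_div_iff₀ hm]
  have h1 := h (fun j ik => if ik.1 = a j then ψ j ik.2 else 0) fun j => by
    rw [Fintype.sum_prod_type, Finset.sum_eq_single (a j)] <;> simp +contextual [hψ]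
  have hv : ∀ b : ∀ j, ι j, prodVec (fun j k => if b j = a j then ψ j k else 0) =
      if b = a then prodVec ψ else 0 := by
    intro b
    by_cases hb : b = a
    · subst hb; simp
    · rw [if_neg hb]
      obtain ⟨j, hj⟩ := Function.ne_iff.mp hb
      ext k
      exact Finset.prod_eq_zero (mem_univ j) (if_neg hj)
  rw [dotProduct_tensor_mulVec] at h1
  simp only [hv] at h1
  rw [Finset.sum_eq_single a (fun b _ hb => by simp [hb]) (by simp),
    Finset.sum_eq_single a (fun b _ hb => by simp [hb]) (by simp), if_pos rfl, ha,
    Complex.re_ofReal_mul] at h1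
  linarith

theorem lambdaSq_tensor {ρ : Op ι} {m : ℝ} (hm : 0 < m) (hρ : AbsProductBound ρ m)
    {a : ∀ j, ι j} (ha : ρ a a = m) {σ : Op κ} (hσ : IsState σ) :
    lambdaSq (tensor ρ σ) = m * lambdaSq σ := by
  have := hσ.nonempty
  have : ∀ j, Nonempty (ι j) := fun j => ⟨a j⟩
  apply le_antisymm
  · exact lambdaSq_le_iff.mpr
      (hρ.productBound_tensor hσ.1 hσ.lambdaSq_pos.le (lambdaSq_le_iff.mp le_rfl))
  · have h := lambdaSq_le_iff.mpr
      ((lambdaSq_le_iff.mp (le_refl (lambdaSq (tensor ρ σ)))).of_tensor hm ha)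
    rw [le_div_iff₀ hm] at h
    linarith

theorem AbsProductBound.productBound {ρ : Op ι} {l : ℝ} (h : AbsProductBound ρ l) :
    ProductBound ρ l := by
  intro ψ hψ
  refine le_trans ?_ (h (fun j i => ‖ψ j i‖) (fun _ _ => norm_nonneg _) hψ)
  refine (Complex.re_le_norm _).trans ?_
  rw [dotProduct]
  refine (norm_sum_le _ _).trans (Finset.sum_le_sum fun a _ => ?_)
  rw [Matrix.mulVec, dotProduct, Finset.mul_sum]
  refine (norm_sum_le _ _).trans (Finset.sum_le_sum fun b _ => ?_)
  simp only [norm_mul, Pi.star_apply, norm_star, prodVec, norm_prod]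
  exact le_of_eq (by ring)

theorem lambdaSq_eq [∀ j, Nonempty (ι j)] {ρ : Op ι} {m : ℝ} (hρ : ProductBound ρ m)
    {a : ∀ j, ι j} (ha : ρ a a = m) : lambdaSq ρ = m := by
  apply le_antisymm (lambdaSq_le_iff.mpr hρ)
  have := (lambdaSq_le_iff.mp (le_refl (lambdaSq ρ))).re_apply_self_le a
  rwa [ha, Complex.ofReal_re] at this

theorem ProductBound.submatrix {M : Op κ} {L : ℝ} (h : ProductBound M L)
    (e : ∀ j, ι j ≃ κ j) :
    ProductBound (M.submatrix (fun a j => e j (a j)) (fun a j => e j (a j))) L := by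
  intro ψ hψ
  have h1 := h (fun j k => ψ j ((e j).symm k)) fun j => by
    rw [← hψ j]
    exact (e j).symm.sum_comp fun i => ‖ψ j i‖ ^ 2
  refine le_of_eq_of_le ?_ h1
  congr 1
  simp only [dotProduct, Matrix.mulVec]
  refine Eq.trans ?_ ((Equiv.piCongrRight e).sum_comp _)
  refine Finset.sum_congr rfl fun a _ => ?_
  rw [← (Equiv.piCongrRight e).sum_comp]
  simp [prodVec]
  left
  rfl

end Product

/-! ### Tensor powers -/

/-- The `n`-fold product of a distribution on `∀ j, ι j`. -/
def powDist {N : ℕ} {ι : Fin N → Type} (d : (∀ j, ι j) → ℝ) (n : ℕ) :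
    (∀ j, Fin n → ι j) → ℝ :=
  fun a => ∏ m, d fun j => a j m

theorem tensorPow_diagonal {N : ℕ} {ι : Fin N → Type} [∀ j, DecidableEq (ι j)]
    (d : (∀ j, ι j) → ℝ) (n : ℕ) :
    tensorPow (diagonal fun a => (d a : ℂ) : Op ι) n =
      diagonal fun a => (powDist d n a : ℂ) := by
  ext a b
  simp only [tensorPow, Matrix.of_apply, Matrix.diagonal_apply, powDist]
  by_cases h : a = b
  · subst h; simp
  · rw [if_neg h]
    have : ∃ m, (fun j => a j m) ≠ fun j => b j m := by
      by_contra! hc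
      exact h (funext fun j => funext fun m => congrFun (hc m) j)
    obtain ⟨m, hm⟩ := this
    exact Finset.prod_eq_zero (mem_univ m) (if_neg hm)

theorem tensorPow_one {N : ℕ} {ι : Fin N → Type} [∀ j, DecidableEq (ι j)] (n : ℕ) :
    tensorPow (1 : Op ι) n = 1 := by
  have := tensorPow_diagonal (ι := ι) (fun _ => 1) n
  simpa [powDist] using this

section Power

variable {N : ℕ} {ι : Fin N → Type} [∀ j, Fintype (ι j)]

/-- Distributivity, after regrouping indices by copy instead of by party. -/
theorem sum_prod_copies {R : Type} [CommSemiring R] {n : ℕ} (f : Fin n → (∀ j, ι j) → R) :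
    ∑ a : ∀ j, Fin n → ι j, ∏ m, f m (fun j => a j m) = ∏ m, ∑ c, f m c := by
  classical
  rw [Finset.prod_univ_sum, Fintype.piFinset_univ,
    ← (Equiv.piComm fun (j : Fin N) (_ : Fin n) => ι j).sum_comp]
  rfl

theorem tensorPow_mul (A B : Op ι) (n : ℕ) :
    tensorPow (A * B) n = tensorPow A n * tensorPow B n := by
  ext a b
  simp only [tensorPow, Matrix.mul_apply, Matrix.of_apply, ← Finset.prod_mul_distrib]
  exact (sum_prod_copies fun m c => A (fun j => a j m) c * B c (fun j => b j m)).symm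

theorem trace_tensorPow (A : Op ι) (n : ℕ) : (tensorPow A n).trace = A.trace ^ n := by
  simp only [Matrix.trace, Matrix.diag_apply, tensorPow, Matrix.of_apply]
  rw [sum_prod_copies fun (_ : Fin n) c => A c c, Finset.prod_const, Finset.card_univ,
    Fintype.card_fin]

theorem tensorPow_smul {N : ℕ} {ι : Fin N → Type} (c : ℂ) (A : Op ι) (n : ℕ) :
    tensorPow (c • A) n = c ^ n • tensorPow A n := by
  ext a b
  simp [tensorPow, Finset.prod_mul_distrib]

theorem conjTranspose_tensorPow {N : ℕ} {ι : Fin N → Type} (A : Op ι) (n : ℕ) :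
    tensorPow Aᴴ n = (tensorPow A n)ᴴ := by
  ext a b
  simp [tensorPow, Matrix.conjTranspose_apply]

theorem powDist_nonneg {N : ℕ} {ι : Fin N → Type} {d : (∀ j, ι j) → ℝ} (hd : ∀ i, 0 ≤ d i)
    (n : ℕ) (a : ∀ j, Fin n → ι j) : 0 ≤ powDist d n a :=
  Finset.prod_nonneg fun _ _ => hd _

theorem powDist_ne_zero {N : ℕ} {ι : Fin N → Type} {d : (∀ j, ι j) → ℝ} {n : ℕ}
    {a : ∀ j, Fin n → ι j} : powDist d n a ≠ 0 ↔ ∀ m, d (fun j => a j m) ≠ 0 := by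
  simp [powDist, Finset.prod_ne_zero_iff]

theorem sum_powDist {d : (∀ j, ι j) → ℝ} (hd : ∑ i, d i = 1) (n : ℕ) :
    ∑ a, powDist d n a = 1 := by
  simp only [powDist]
  rw [sum_prod_copies fun (_ : Fin n) c => d c, hd, Finset.prod_const_one]

theorem sum_powDist_mul_logb {p w : (∀ j, ι j) → ℝ} (hp : ∑ i, p i = 1)
    (hpw : ∀ i, p i ≠ 0 → w i ≠ 0) (n : ℕ) :
    ∑ a, powDist p n a * Real.logb 2 (powDist w n a) = n * ∑ i, p i * Real.logb 2 (w i) := by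
  -- Each summand of the expanded logarithm is again a product over copies, with the logarithm
  -- inserted at copy `m` alone, so the sum over `a` factorizes.
  have h1 : ∀ a, powDist p n a * Real.logb 2 (powDist w n a) =
      ∑ m, ∏ m', (p (fun j => a j m') *
        if m = m' then Real.logb 2 (w fun j => a j m') else 1) := by
    intro a
    simp only [Finset.prod_mul_distrib, Finset.prod_ite_eq, mem_univ, if_true]
    rw [← Finset.mul_sum]
    by_cases h : powDist p n a = 0
    · rw [h, zero_mul, show ∏ m, p (fun j => a j m) = 0 from h, zero_mul]
    · rw [← ne_eq, powDist_ne_zero] at h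
      unfold powDist
      rw [Real.logb_prod _ _ fun m _ => hpw _ (h m)]
  simp only [h1]
  rw [Finset.sum_comm]
  have h2 : ∀ m : Fin n, ∑ a : ∀ j, Fin n → ι j, ∏ m', (p (fun j => a j m') *
      if m = m' then Real.logb 2 (w fun j => a j m') else 1) =
      ∑ i, p i * Real.logb 2 (w i) := by
    intro m
    rw [sum_prod_copies fun m' c => p c * if m = m' then Real.logb 2 (w c) else 1,
      Finset.prod_eq_single m]
    · simp
    · intro m' _ hm
      simp [hm.symm, hp]
    · simp
  rw [Finset.sum_congr rfl fun m _ => h2 m, Finset.sum_const, Finset.card_univ, Fintype.card_fin,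
    nsmul_eq_mul]

variable [∀ j, DecidableEq (ι j)]

theorem tensorPow_spectralOp (U : Op ι) (d : (∀ j, ι j) → ℝ) (n : ℕ) :
    tensorPow (spectralOp U d) n = spectralOp (tensorPow U n) (powDist d n) := by
  rw [spectralOp, tensorPow_mul, tensorPow_mul, tensorPow_diagonal, conjTranspose_tensorPow]
  rfl

theorem conjTranspose_tensorPow_mul_self {U : Op ι} (hU : Uᴴ * U = 1) (n : ℕ) :
    (tensorPow U n)ᴴ * tensorPow U n = 1 := by
  rw [← conjTranspose_tensorPow, ← tensorPow_mul, hU, tensorPow_one]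

theorem posSemidef_tensorPow {ρ : Op ι} (h : ρ.PosSemidef) (n : ℕ) :
    (tensorPow ρ n).PosSemidef := by
  obtain ⟨V, -, -, hs, -⟩ := exists_spectralOp h.isHermitian
  rw [hs, tensorPow_spectralOp]
  exact posSemidef_spectralOp _ (powDist_nonneg h.eigenvalues_nonneg n)

theorem isState_tensorPow {ρ : Op ι} (h : IsState ρ) (n : ℕ) : IsState (tensorPow ρ n) :=
  ⟨posSemidef_tensorPow h.1 n, by rw [trace_tensorPow, h.2, one_pow]⟩

theorem AbsProductBound.productBound_tensorPow {ρ : Op ι} {m : ℝ} (hm : 0 ≤ m)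
    (h : AbsProductBound ρ m) (hρ : IsState ρ) (n : ℕ) :
    ProductBound (tensorPow ρ n) (m ^ n) := by
  have := hρ.nonempty
  induction n with
  -- With no copies each local space is one-dimensional, so a local unit vector is a phase.
  | zero =>
    intro ψ hψ
    have h0 : ∀ j, ‖ψ j default‖ = 1 := fun j => by
      have := hψ j
      rw [Fintype.sum_unique] at this
      exact (pow_eq_one_iff_of_nonneg (norm_nonneg _) two_ne_zero).mp this
    rw [dotProduct, Fintype.sum_unique, Matrix.mulVec, dotProduct, Fintype.sum_unique]
    refine (Complex.re_le_norm _).trans ?_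
    have h1 : ‖prodVec ψ fun _ => default‖ = 1 := by
      rw [prodVec, norm_prod]
      exact Finset.prod_eq_one fun j _ => h0 j
    simp [h1, tensorPow]
  | succ n ih =>
    have h1 := h.productBound_tensor (isState_tensorPow hρ n).1 (pow_nonneg hm n) ih
    -- Each party splits off its first copy, turning the power into `ρ` tensored with the previous
    -- power.
    have h2 := h1.submatrix fun j => (Fin.consEquiv fun _ : Fin (n + 1) => ι j).symm
    rw [pow_succ']
    convert h2 using 1
    ext a b
    simp only [tensorPow, tensor, Matrix.of_apply, Matrix.submatrix_apply, Fin.prod_univ_succ]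
    rfl

/-! ### Separability of diagonal states -/

theorem diagonal_mem_SEP {δ : (∀ j, ι j) → ℝ} (hδ : ∀ a, 0 ≤ δ a) (hδ1 : ∑ a, δ a = 1) :
    (diagonal fun a => (δ a : ℂ) : Op ι) ∈ SEP ι := by
  have h : (diagonal fun a => (δ a : ℂ) : Op ι) =
      ∑ a, δ a • proj (prodVec fun j => (Pi.single (a j) 1 : ι j → ℂ)) := by
    ext b c
    simp only [Matrix.sum_apply, Matrix.smul_apply, proj, Matrix.vecMulVec_apply, Pi.star_apply,
      prodVec, Pi.single_apply, Finset.prod_ite_zero, Finset.prod_const_one, mem_univ,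
      forall_const, ← funext_iff, Matrix.diagonal_apply]
    rw [Finset.sum_eq_single b (fun a _ ha => by simp [ha.symm]) (by simp)]
    by_cases hbc : b = c
    · simp [hbc]
    · simp [hbc, Ne.symm hbc]
  rw [h]
  refine (convex_convexHull ℝ _).sum_mem (fun a _ => hδ a) hδ1 fun a _ => ?_
  refine proj_prodVec_mem_SEP fun j => ?_
  rw [Finset.sum_eq_single (a j)] <;> simp +contextual

/-! ### Evaluation of the relative entropy of entanglement -/

/-- The relative entropy of entanglement of a state for which the bound given by a witness agrees
with the relative entropy with respect to its diagonal part. -/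
theorem REE_spectralOp_eq {U : Op ι} (hU : Uᴴ * U = 1) {p w δ : (∀ j, ι j) → ℝ}
    (hp : ∀ i, 0 ≤ p i) (hp1 : ∑ i, p i = 1) (hw : ∀ i, 0 ≤ w i)
    (hpw : ∀ i, p i ≠ 0 → w i ≠ 0) (hbound : ProductBound (spectralOp U w) 1)
    (hδ : ∀ a, spectralOp U p a a = (δ a : ℂ))
    {L : ℝ}
    (hLw : ∑ i, p i * Real.logb 2 (w i) = L)
    (hLδ : ∑ i, p i * Real.logb 2 (p i) - ∑ a, δ a * Real.logb 2 (δ a) = L) :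
    REE N ι (spectralOp U p) = (L : EReal) := by
  apply le_antisymm
  · have hδ0 : ∀ a, 0 ≤ δ a := fun a => by
      have := (posSemidef_spectralOp U hp).diag_nonneg (i := a)
      rw [hδ] at this
      exact_mod_cast this
    have hδ1 : ∑ a, δ a = 1 := by
      have h := trace_spectralOp hU p
      rw [hp1, Matrix.trace] at h
      simp only [Matrix.diag_apply, hδ] at h
      exact_mod_cast h
    refine (iInf₂_le _ (diagonal_mem_SEP hδ0 hδ1)).trans ?_
    rw [relEntropy_diagonal hU hp hδ, hLδ]
  · refine le_iInf₂ fun σ hσ => ?_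
    rw [← hLw]
    exact le_relEntropy_of_witness hU hp hp1 hw hpw (posSemidef_of_mem_SEP hσ)
      (hbound.re_trace_mul_le hσ)

theorem REE_tensorPow_spectralOp_eq {U : Op ι} (hU : Uᴴ * U = 1) {p w δ : (∀ j, ι j) → ℝ}
    (hp : ∀ i, 0 ≤ p i) (hp1 : ∑ i, p i = 1) (hw : ∀ i, 0 ≤ w i)
    (hpw : ∀ i, p i ≠ 0 → w i ≠ 0) {n : ℕ}
    (hbound : ProductBound (tensorPow (spectralOp U w) n) 1)
    (hδ : ∀ a, spectralOp U p a a = (δ a : ℂ))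
    {L : ℝ}
    (hLw : ∑ i, p i * Real.logb 2 (w i) = L)
    (hLδ : ∑ i, p i * Real.logb 2 (p i) - ∑ a, δ a * Real.logb 2 (δ a) = L) :
    REE N _ (tensorPow (spectralOp U p) n) = ((n * L : ℝ) : EReal) := by
  have hδ1 : ∑ a, δ a = 1 := by
    have h := trace_spectralOp hU p
    rw [hp1, Matrix.trace] at h
    simp only [Matrix.diag_apply, hδ] at h
    exact_mod_cast h
  rw [tensorPow_spectralOp] at hbound ⊢
  refine REE_spectralOp_eq (δ := powDist δ n) (conjTranspose_tensorPow_mul_self hU n)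
    (powDist_nonneg hp n) (sum_powDist hp1 n) (powDist_nonneg hw n)
    (fun a h => ?_) hbound (fun a => ?_) ?_ ?_
  · rw [powDist_ne_zero] at h ⊢
    exact fun m => hpw _ (h m)
  · rw [← tensorPow_spectralOp]
    simp only [tensorPow, Matrix.of_apply, hδ, powDist, Complex.ofReal_prod]
  · rw [sum_powDist_mul_logb hp1 hpw, hLw]
  · rw [sum_powDist_mul_logb hp1 (fun _ h => h), sum_powDist_mul_logb hδ1 (fun _ h => h),
      ← mul_sub, hLδ]

end Power

theorem GM_eq {N : ℕ} {ι : Fin N → Type} [∀ j, Fintype (ι j)] [∀ j, DecidableEq (ι j)]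
    {ρ : Op ι} (h : 0 ≤ lambdaSq ρ) :
    GM N ι ρ = ((-Real.logb 2 (lambdaSq ρ) : ℝ) : EReal) := by
  rw [GM, Real.logb, Real.logb, Real.log_sqrt h]
  congr 1
  ring

theorem hasRegularization_of_eq_mul {N : ℕ} {E : Functional N} {ι : Fin N → Type}
    [∀ j, Fintype (ι j)] [∀ j, DecidableEq (ι j)] {ρ : Op ι} {L : ℝ}
    (h : ∀ n, E (fun j => Fin n → ι j) (tensorPow ρ n) = ((n * L : ℝ) : EReal)) :
    HasRegularization E ρ (L : EReal) := by
  refine tendsto_const_nhds.congr' ?_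
  -- At `n = 0` the quotient is `0 / 0`, hence discarded.
  filter_upwards [Filter.eventually_gt_atTop 0] with n hn
  have hn' : (n : ℝ) ≠ 0 := by positivity
  rw [h, ← EReal.coe_div, mul_div_cancel_left₀ _ hn']

/-! ### The operators `A |Ψ⟩⟨Ψ| + C ∑ₖ (|u_k⟩⟨u_k| + |v_k⟩⟨v_k|)` -/

section Dur

variable {N : ℕ}

/-- The bit string of `|u_k⟩`. -/
def uBits (k : Fin N) : Fin N → Fin 2 := Function.update (fun _ => 0) k 1

/-- The bit string of `|v_k⟩`. -/
def vBits (k : Fin N) : Fin N → Fin 2 := Function.update (fun _ => 1) k 0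

/-- The function with values `A` at `0…0`, `B` at `1…1` and `C` at the strings of `u_k`, `v_k`. -/
def durWeights (N : ℕ) (A B C : ℝ) (a : Fin N → Fin 2) : ℝ :=
  A * (if a = fun _ => 0 then 1 else 0) + B * (if a = fun _ => 1 then 1 else 0) +
    C * ∑ k, ((if a = uBits k then 1 else 0) + (if a = vBits k then 1 else 0))

theorem durWeights_nonneg {A B C : ℝ} (hA : 0 ≤ A) (hB : 0 ≤ B) (hC : 0 ≤ C)
    (a : Fin N → Fin 2) : 0 ≤ durWeights N A B C a := by
  unfold durWeights
  have : 0 ≤ ∑ k : Fin N, ((if a = uBits k then (1 : ℝ) else 0) +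
      (if a = vBits k then 1 else 0)) :=
    Finset.sum_nonneg fun k _ => by positivity
  positivity

theorem sum_durWeights_mul (A B C : ℝ) (g : (Fin N → Fin 2) → ℝ) :
    ∑ a, durWeights N A B C a * g a = A * g (fun _ => 0) + B * g (fun _ => 1) +
      C * ∑ k, (g (uBits k) + g (vBits k)) := by
  have h : ∀ b : Fin N → Fin 2, ∑ a, (if a = b then (1 : ℝ) else 0) * g a = g b := fun b => by
    simp
  simp only [durWeights, add_mul, mul_assoc, Finset.sum_add_distrib, ← Finset.mul_sum,
    Finset.sum_mul, h]
  congr 2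
  congr 1 <;> rw [Finset.sum_comm] <;> exact Finset.sum_congr rfl fun k _ => h _

/-! ### Combinatorics of the bit strings -/

theorem exists_ne_ne (hN : 4 ≤ N) (k l : Fin N) : ∃ j, j ≠ k ∧ j ≠ l := by
  obtain ⟨j, -, hj⟩ := Finset.exists_mem_notMem_of_card_lt_card
    (s := {k, l}) (t := (univ : Finset (Fin N)))
    (by rw [Finset.card_univ, Fintype.card_fin]; exact (Finset.card_le_two).trans_lt (by omega))
  exact ⟨j, by simpa using hj⟩

theorem uBits_injective : Function.Injective (uBits (N := N)) := by
  intro k l h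
  by_contra hkl
  have := congrFun h k
  simp [uBits, hkl] at this

theorem vBits_injective : Function.Injective (vBits (N := N)) := by
  intro k l h
  by_contra hkl
  have := congrFun h k
  simp [vBits, hkl] at this

theorem uBits_ne_vBits (hN : 4 ≤ N) (k l : Fin N) : uBits k ≠ vBits l := by
  intro h
  obtain ⟨j, hk, hl⟩ := exists_ne_ne hN k l
  have := congrFun h j
  simp [uBits, vBits, hk, hl] at this

theorem uBits_ne_zero (k : Fin N) : uBits k ≠ fun _ => 0 := by
  intro h
  have := congrFun h k
  simp [uBits] at this

theorem vBits_ne_one (k : Fin N) : vBits k ≠ fun _ => 1 := by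
  intro h
  have := congrFun h k
  simp [vBits] at this

theorem uBits_ne_one (hN : 4 ≤ N) (k : Fin N) : uBits k ≠ fun _ => 1 := by
  intro h
  obtain ⟨j, hk, -⟩ := exists_ne_ne hN k k
  have := congrFun h j
  simp [uBits, hk] at this

theorem vBits_ne_zero (hN : 4 ≤ N) (k : Fin N) : vBits k ≠ fun _ => 0 := by
  intro h
  obtain ⟨j, hk, -⟩ := exists_ne_ne hN k k
  have := congrFun h j
  simp [vBits, hk] at this

theorem zeros_ne_ones (hN : 4 ≤ N) : (fun _ : Fin N => (0 : Fin 2)) ≠ fun _ => 1 := by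
  intro h
  have := congrFun h ⟨0, by omega⟩
  simp at this

theorem durWeights_zeros (hN : 4 ≤ N) (A B C : ℝ) :
    durWeights N A B C (fun _ => 0) = A := by
  simp [durWeights, zeros_ne_ones hN, (uBits_ne_zero _).symm, (vBits_ne_zero hN _).symm]

theorem durWeights_ones (hN : 4 ≤ N) (A B C : ℝ) :
    durWeights N A B C (fun _ => 1) = B := by
  simp [durWeights, (zeros_ne_ones hN).symm, (uBits_ne_one hN _).symm, (vBits_ne_one _).symm]

theorem durWeights_uBits (hN : 4 ≤ N) (A B C : ℝ) (k : Fin N) :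
    durWeights N A B C (uBits k) = C := by
  simp [durWeights, uBits_ne_one hN, uBits_ne_zero, uBits_ne_vBits hN, uBits_injective.eq_iff]

theorem durWeights_vBits (hN : 4 ≤ N) (A B C : ℝ) (k : Fin N) :
    durWeights N A B C (vBits k) = C := by
  simp [durWeights, vBits_ne_one, vBits_ne_zero hN, (uBits_ne_vBits hN _ _).symm,
    vBits_injective.eq_iff]

theorem durWeights_support (a : Fin N → Fin 2) :
    a = (fun _ => 0) ∨ a = (fun _ => 1) ∨ (∃ k, a = uBits k) ∨ (∃ k, a = vBits k) ∨
      ∀ A B C, durWeights N A B C a = 0 := by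
  by_cases h0 : a = fun _ => 0
  · exact Or.inl h0
  by_cases h1 : a = fun _ => 1
  · exact Or.inr (Or.inl h1)
  by_cases hu : ∃ k, a = uBits k
  · exact Or.inr (Or.inr (Or.inl hu))
  by_cases hv : ∃ k, a = vBits k
  · exact Or.inr (Or.inr (Or.inr (Or.inl hv)))
  push Not at hu hv
  refine Or.inr (Or.inr (Or.inr (Or.inr fun A B C => ?_)))
  simp [durWeights, h0, h1, hu, hv]

/-- A string of weight two. -/
def pairBits (N : ℕ) : Fin N → Fin 2 := fun j => if j.val < 2 then 1 else 0

/-- The complement of `pairBits`. -/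
def copairBits (N : ℕ) : Fin N → Fin 2 := fun j => if j.val < 2 then 0 else 1

theorem pairBits_ne_copairBits (hN : 4 ≤ N) : pairBits N ≠ copairBits N := by
  intro h
  have := congrFun h ⟨0, by omega⟩
  simp [pairBits, copairBits] at this

theorem uBits_apply_ne (k j j' : Fin N) (h : j ≠ j') : uBits k j = 0 ∨ uBits k j' = 0 := by
  by_cases hj : j = k
  · exact Or.inr (by simp [uBits, ← hj, h.symm])
  · exact Or.inl (by simp [uBits, hj])

theorem vBits_apply_ne (k j j' : Fin N) (h : j ≠ j') : vBits k j = 1 ∨ vBits k j' = 1 := by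
  by_cases hj : j = k
  · exact Or.inr (by simp [vBits, ← hj, h.symm])
  · exact Or.inl (by simp [vBits, hj])

theorem durWeights_eq_zero_of_two_two {a : Fin N → Fin 2} {i i' j j' : Fin N}
    (hi : i ≠ i') (hj : j ≠ j') (h0 : a i = 0) (h0' : a i' = 0) (h1 : a j = 1) (h1' : a j' = 1)
    (A B C : ℝ) : durWeights N A B C a = 0 := by
  rcases durWeights_support a with h | h | ⟨k, h⟩ | ⟨k, h⟩ | h
  · simp [h] at h1
  · simp [h] at h0
  · rcases uBits_apply_ne k j j' hj with h' | h' <;> simp_all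
  · rcases vBits_apply_ne k i i' hi with h' | h' <;> simp_all
  · exact h A B C

/-- The strings `0…0`, `1…1`, `u_k`, `v_k` and the complementary pair are all distinct, so at most
one indicator is `1`. For `N ≥ 4` both members of the pair have two zeros and two ones, unlike the
others. -/
theorem durWeights_add_pair_le (hN : 4 ≤ N) (a : Fin N → Fin 2) :
    durWeights N 1 1 1 a + (if a = pairBits N then 1 else 0) +
      (if a = copairBits N then 1 else 0) ≤ 1 := by
  have hd : ∀ m n (hm : m < N) (hn : n < N), m ≠ n → (⟨m, hm⟩ : Fin N) ≠ ⟨n, hn⟩ := by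
    intro m n _ _ h h'
    exact h (Fin.mk.inj_iff.mp h')
  by_cases hp : a = pairBits N
  · have h : durWeights N 1 1 1 a = 0 := by
      rw [hp]
      apply durWeights_eq_zero_of_two_two (hd 2 3 (by omega) (by omega) (by omega))
        (hd 0 1 (by omega) (by omega) (by omega)) <;> simp [pairBits]
    have h' : a ≠ copairBits N := hp ▸ pairBits_ne_copairBits hN
    rw [h, if_pos hp, if_neg h']; norm_num
  by_cases hq : a = copairBits N
  · have h : durWeights N 1 1 1 a = 0 := by
      rw [hq]
      apply durWeights_eq_zero_of_two_two (hd 0 1 (by omega) (by omega) (by omega))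
        (hd 2 3 (by omega) (by omega) (by omega)) <;> simp [copairBits]
    rw [h, if_neg hp, if_pos hq]; norm_num
  rw [if_neg hp, if_neg hq, add_zero, add_zero]
  rcases durWeights_support a with h | h | ⟨k, h⟩ | ⟨k, h⟩ | h
  · rw [h, durWeights_zeros hN]
  · rw [h, durWeights_ones hN]
  · rw [h, durWeights_uBits hN]
  · rw [h, durWeights_vBits hN]
  · rw [h]; norm_num

/-- The cross term `2 C₀ C₁` is paid for by the squared amplitudes of the complementary pair, which
the rest of the sum leaves unused. -/
theorem prod_amplitudes_bound (hN : 4 ≤ N) {c : Fin N → Fin 2 → ℝ}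
    (hc : ∀ j, ∑ i, c j i ^ 2 = 1) :
    (∏ j, c j 0 + ∏ j, c j 1) ^ 2 +
      ∑ k, ((∏ j, c j (uBits k j)) ^ 2 + (∏ j, c j (vBits k j)) ^ 2) ≤ 1 := by
  have hsum : ∑ a : Fin N → Fin 2, (∏ j, c j (a j)) ^ 2 = 1 := by
    simp only [← Finset.prod_pow]
    have := Finset.prod_univ_sum (fun _ : Fin N => (univ : Finset (Fin 2)))
      (fun j i => c j i ^ 2)
    rw [Fintype.piFinset_univ] at this
    rw [← this, Finset.prod_eq_one fun j _ => hc j]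
  have hle := Finset.sum_le_sum fun a (_ : a ∈ univ) =>
    mul_le_mul_of_nonneg_right (durWeights_add_pair_le hN a) (sq_nonneg (∏ j, c j (a j)))
  simp only [add_mul, Finset.sum_add_distrib, sum_durWeights_mul, ite_mul, one_mul, zero_mul,
    Finset.sum_ite_eq', mem_univ, if_true, hsum] at hle
  -- Any two complementary strings use each factor `c j 0` and `c j 1` exactly once.
  have hswap : (∏ j, c j 0) * ∏ j, c j 1 =
      (∏ j, c j (pairBits N j)) * ∏ j, c j (copairBits N j) := by
    rw [← Finset.prod_mul_distrib, ← Finset.prod_mul_distrib]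
    refine Finset.prod_congr rfl fun j _ => ?_
    unfold pairBits copairBits
    split_ifs <;> ring
  rw [← Finset.sum_add_distrib] at hle
  nlinarith [sq_nonneg (∏ j, c j (pairBits N j) - ∏ j, c j (copairBits N j))]

/-- The form `∑ |M a b| C a C b`. -/
noncomputable def absForm {n : Type} [Fintype n] (C : n → ℝ) (M : Matrix n n ℂ) : ℝ :=
  ∑ a, ∑ b, ‖M a b‖ * C a * C b

section AbsForm

variable {n : Type} [Fintype n] {C : n → ℝ}

theorem absForm_add_le (hC : ∀ a, 0 ≤ C a) (M M' : Matrix n n ℂ) :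
    absForm C (M + M') ≤ absForm C M + absForm C M' := by
  simp only [absForm, ← Finset.sum_add_distrib, ← add_mul]
  refine Finset.sum_le_sum fun a _ => Finset.sum_le_sum fun b _ => ?_
  have := hC a
  have := hC b
  gcongr
  exact norm_add_le _ _

theorem absForm_smul {x : ℝ} (hx : 0 ≤ x) (M : Matrix n n ℂ) :
    absForm C ((x : ℂ) • M) = x * absForm C M := by
  simp only [absForm, Finset.mul_sum, Matrix.smul_apply, smul_eq_mul, norm_mul, Complex.norm_real,
    Real.norm_of_nonneg hx, mul_assoc]

theorem absForm_sum_le {κ : Type} (hC : ∀ a, 0 ≤ C a) (s : Finset κ) (M : κ → Matrix n n ℂ) :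
    absForm C (∑ k ∈ s, M k) ≤ ∑ k ∈ s, absForm C (M k) := by
  classical
  induction s using Finset.induction_on with
  | empty => simp [absForm]
  | insert k s hk ih =>
    rw [Finset.sum_insert hk, Finset.sum_insert hk]
    exact (absForm_add_le hC _ _).trans (by gcongr)

theorem absForm_proj (v : n → ℂ) : absForm C (proj v) = (∑ a, ‖v a‖ * C a) ^ 2 := by
  rw [pow_two, Finset.sum_mul_sum, absForm]
  refine Finset.sum_congr rfl fun a _ => Finset.sum_congr rfl fun b _ => ?_
  rw [proj, Matrix.vecMulVec_apply, norm_mul, Pi.star_apply, norm_star]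
  ring

end AbsForm

theorem sum_norm_ket_mul (C : (Fin N → Fin 2) → ℝ) (b : Fin N → Fin 2) :
    ∑ a, ‖ket b a‖ * C a = C b := by
  rw [Finset.sum_eq_single b] <;> simp +contextual [ket]

theorem sum_norm_ghz_mul_le {C : (Fin N → Fin 2) → ℝ} (hC : ∀ a, 0 ≤ C a) (α : ℝ) :
    ∑ a, ‖ghz N α a‖ * C a ≤ 1 / √2 * (C (fun _ => 0) + C fun _ => 1) := by
  rw [← sum_norm_ket_mul C fun _ => 0, ← sum_norm_ket_mul C fun _ => 1,
    ← Finset.sum_add_distrib, Finset.mul_sum]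
  refine Finset.sum_le_sum fun a _ => ?_
  rw [← add_mul, ← mul_assoc]
  refine mul_le_mul_of_nonneg_right ?_ (hC a)
  rw [ghz, Pi.smul_apply, smul_eq_mul, norm_mul, Complex.norm_real,
    Real.norm_of_nonneg (by positivity), Pi.add_apply, Pi.smul_apply, smul_eq_mul]
  refine mul_le_mul_of_nonneg_left ((norm_add_le _ _).trans_eq ?_) (by positivity)
  rw [norm_mul, Complex.norm_exp_ofReal_mul_I, one_mul]

theorem absProductBound_durState (hN : 4 ≤ N) (α : ℝ) {x m : ℝ} (hx0 : 0 ≤ x) (hx1 : x ≤ 1)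
    (hm1 : x / 2 ≤ m) (hm2 : (1 - x) / (2 * N) ≤ m) :
    AbsProductBound (durState N α x) m := by
  intro c hc0 hc
  set C : (Fin N → Fin 2) → ℝ := fun a => ∏ j, c j (a j)
  have hC : ∀ a, 0 ≤ C a := fun a => Finset.prod_nonneg fun j _ => hc0 _ _
  have hy : 0 ≤ (1 - x) / (2 * N) := div_nonneg (by linarith) (by positivity)
  have hm : 0 ≤ m := hy.trans hm2
  have key : (C (fun _ => 0) + C fun _ => 1) ^ 2 +
      ∑ k, (C (uBits k) ^ 2 + C (vBits k) ^ 2) ≤ 1 := prod_amplitudes_bound hN hc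
  have hghz : absForm C (proj (ghz N α)) ≤ (C (fun _ => 0) + C fun _ => 1) ^ 2 / 2 := by
    rw [absForm_proj]
    calc (∑ a, ‖ghz N α a‖ * C a) ^ 2
        ≤ (1 / √2 * (C (fun _ => 0) + C fun _ => 1)) ^ 2 :=
          pow_le_pow_left₀ (Finset.sum_nonneg fun a _ => mul_nonneg (norm_nonneg _) (hC a))
            (sum_norm_ghz_mul_le hC α) 2
      _ = _ := by
          rw [mul_pow, div_pow, Real.sq_sqrt (by norm_num)]
          ring
  have huv : absForm C (∑ k : Fin N, (proj (uVec k) + proj (vVec k))) ≤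
      ∑ k, (C (uBits k) ^ 2 + C (vBits k) ^ 2) := by
    refine (absForm_sum_le hC _ _).trans (Finset.sum_le_sum fun k _ => ?_)
    refine (absForm_add_le hC _ _).trans_eq ?_
    rw [absForm_proj, absForm_proj, uVec, vVec, sum_norm_ket_mul, sum_norm_ket_mul]
    rfl
  have hnn : 0 ≤ ∑ k, (C (uBits k) ^ 2 + C (vBits k) ^ 2) :=
    Finset.sum_nonneg fun k _ => by positivity
  calc absForm C (durState N α x)
      ≤ x * absForm C (proj (ghz N α)) + (1 - x) / (2 * N) *
          absForm C (∑ k : Fin N, (proj (uVec k) + proj (vVec k))) := by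
        refine (absForm_add_le hC _ _).trans_eq ?_
        rw [absForm_smul hx0, absForm_smul hy]
    _ ≤ x * ((C (fun _ => 0) + C fun _ => 1) ^ 2 / 2) + (1 - x) / (2 * N) *
          ∑ k, (C (uBits k) ^ 2 + C (vBits k) ^ 2) := by gcongr
    _ = x / 2 * (C (fun _ => 0) + C fun _ => 1) ^ 2 + (1 - x) / (2 * N) *
          ∑ k, (C (uBits k) ^ 2 + C (vBits k) ^ 2) := by ring
    _ ≤ m * (C (fun _ => 0) + C fun _ => 1) ^ 2 + m *
          ∑ k, (C (uBits k) ^ 2 + C (vBits k) ^ 2) := by gcongr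
    _ ≤ m := by
        rw [← mul_add]
        exact mul_le_of_le_one_right hm key

/-! ### Spectral decomposition of Dür's states -/

theorem mul_proj_mul_conjTranspose {n : Type} [Fintype n] (U : Matrix n n ℂ) (v : n → ℂ) :
    U * proj v * Uᴴ = proj (U.mulVec v) := by
  rw [proj, Matrix.mul_vecMulVec, Matrix.vecMulVec_mul, proj, Matrix.star_mulVec]

theorem proj_ket (b : Fin N → Fin 2) :
    proj (ket b) = diagonal fun a => if a = b then 1 else 0 := by
  ext a a'
  rw [proj, Matrix.vecMulVec_apply, Pi.star_apply, ket, Matrix.diagonal_apply]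
  by_cases h : a = b
  · subst h
    by_cases h' : a = a'
    · simp [h']
    · simp [h', Ne.symm h']
  · simp [h]

theorem diagonal_durWeights (A B C : ℝ) :
    diagonal (fun a => (durWeights N A B C a : ℂ)) =
      (A : ℂ) • proj (ket fun _ => 0) + (B : ℂ) • proj (ket fun _ => 1) +
        (C : ℂ) • ∑ k : Fin N, (proj (uVec k) + proj (vVec k)) := by
  have hu : ∀ k : Fin N, uVec k = ket (uBits k) := fun _ => rfl
  have hv : ∀ k : Fin N, vVec k = ket (vBits k) := fun _ => rfl
  ext a b
  simp only [hu, hv, proj_ket, Matrix.add_apply, Matrix.smul_apply, Matrix.sum_apply,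
    Matrix.diagonal_apply, durWeights]
  by_cases h : a = b
  · have hc : ∀ (P : Prop) [Decidable P], ((if P then (1 : ℝ) else 0 : ℝ) : ℂ) =
        if P then 1 else 0 := fun P _ => by split_ifs <;> simp
    subst h
    simp only [if_true, Complex.ofReal_add, Complex.ofReal_mul, Complex.ofReal_sum, hc,
      smul_eq_mul]
  · simp [h]

theorem ghz_apply (α : ℝ) (a : Fin N → Fin 2) :
    ghz N α a = ((1 / √2 : ℝ) : ℂ) * ((if a = fun _ => 0 then 1 else 0) +
      Complex.exp (α * Complex.I) * (if a = fun _ => 1 then 1 else 0)) := by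
  simp [ghz, ket, Pi.single_apply]

theorem proj_ghz_apply_self (hN : 4 ≤ N) (α : ℝ) (a : Fin N → Fin 2) :
    proj (ghz N α) a a = (durWeights N (1 / 2) (1 / 2) 0 a : ℂ) := by
  have h2 : (1 / √2 : ℝ) ^ 2 = 1 / 2 := by
    rw [div_pow, Real.sq_sqrt (by norm_num)]; norm_num
  have hn : ‖ghz N α a‖ ^ 2 = durWeights N (1 / 2) (1 / 2) 0 a := by
    rw [ghz_apply, norm_mul, mul_pow, Complex.norm_real, Real.norm_eq_abs, sq_abs, h2, durWeights]
    by_cases h0 : a = fun _ => 0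
    · simp [h0, zeros_ne_ones hN]
    by_cases h1 : a = fun _ => 1
    · simp [h1, (zeros_ne_ones hN).symm, Complex.norm_exp_ofReal_mul_I]
    simp [h0, h1]
  rw [proj, Matrix.vecMulVec_apply, Pi.star_apply, RCLike.star_def, Complex.mul_conj', ← hn]
  push_cast; rfl

/-- The reflection exchanging `|0…0⟩` and the GHZ vector. -/
noncomputable def ghzReflection (N : ℕ) (α : ℝ) : Op (fun _ : Fin N => Fin 2) :=
  1 - ((1 / (1 - 1 / √2) : ℝ) : ℂ) • proj (ket (fun _ => 0) - ghz N α)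

theorem one_div_sqrt_two_lt_one : 1 / √2 < 1 := by
  rw [div_lt_one (by positivity)]
  exact Real.lt_sqrt_of_sq_lt (by norm_num)

theorem star_dotProduct_ket (w : (Fin N → Fin 2) → ℂ) (b : Fin N → Fin 2) :
    star w ⬝ᵥ ket b = star (w b) := by
  simp [ket]

/-- The overlap of `|0…0⟩` with the GHZ vector is the real number `1/√2`, so a Householder
reflection along their difference exchanges them; this squared length fixes its coefficient. -/
theorem reflection_vector_inner_self (hN : 4 ≤ N) (α : ℝ) :
    star (ket (fun _ => 0) - ghz N α) ⬝ᵥ (ket (fun _ => 0) - ghz N α) =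
      ((2 * (1 - 1 / √2) : ℝ) : ℂ) := by
  have h2 : ((1 / √2 : ℝ) : ℂ) ^ 2 = 1 / 2 := by
    rw [← Complex.ofReal_pow, div_pow, Real.sq_sqrt (by norm_num)]; norm_num
  have he : star (Complex.exp (α * Complex.I)) * Complex.exp (α * Complex.I) = 1 := by
    rw [RCLike.star_def, Complex.conj_mul', Complex.norm_exp_ofReal_mul_I]; norm_num
  have h0 : ghz N α (fun _ => 0) = ((1 / √2 : ℝ) : ℂ) := by
    simp [ghz_apply, zeros_ne_ones hN]
  have h1 : ghz N α (fun _ => 1) = ((1 / √2 : ℝ) : ℂ) * Complex.exp (α * Complex.I) := by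
    simp [ghz_apply, (zeros_ne_ones hN).symm]
  have hk0 : (ket (fun _ : Fin N => 0) : _ → ℂ) (fun _ => 0) = 1 := by simp [ket]
  have hk1 : (ket (fun _ : Fin N => 0) : _ → ℂ) (fun _ => 1) = 0 := by
    simp [ket, (zeros_ne_ones hN).symm]
  generalize hs : (1 / √2 : ℝ) = s at *
  rw [dotProduct_sub, star_dotProduct_ket]
  have hg : ∀ w : (Fin N → Fin 2) → ℂ, star w ⬝ᵥ ghz N α =
      (s : ℂ) * (star (w fun _ => 0) + Complex.exp (α * Complex.I) * star (w fun _ => 1)) := by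
    intro w
    rw [ghz, dotProduct_smul, dotProduct_add, dotProduct_smul, star_dotProduct_ket,
      star_dotProduct_ket, hs, smul_eq_mul, smul_eq_mul]
  rw [hg]
  simp only [Pi.sub_apply, h0, h1, hk0, hk1, star_sub, star_mul, star_one, star_zero,
    RCLike.star_def, Complex.conj_ofReal]
  rw [RCLike.star_def] at he
  push_cast
  linear_combination 2 * h2 + (s : ℂ) ^ 2 * he

theorem conjTranspose_ghzReflection_mul_self (hN : 4 ≤ N) (α : ℝ) :
    (ghzReflection N α)ᴴ * ghzReflection N α = 1 := by
  have hself := reflection_vector_inner_self hN α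
  have hlt := one_div_sqrt_two_lt_one
  unfold ghzReflection
  generalize ket (fun _ => 0) - ghz N α = w at *
  generalize (1 / √2 : ℝ) = s at *
  have hs : 1 - s ≠ 0 := by linarith
  have hP : (proj w)ᴴ = proj w := by
    rw [proj, Matrix.conjTranspose_vecMulVec, star_star]
  have hPP : proj w * proj w = ((2 * (1 - s) : ℝ) : ℂ) • proj w := by
    rw [← hself]
    simp only [proj, Matrix.vecMulVec_mul_vecMulVec]
    ext a b
    simp [Matrix.vecMulVec_apply]
    ring
  rw [Matrix.conjTranspose_sub, Matrix.conjTranspose_one, Matrix.conjTranspose_smul, hP,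
    RCLike.star_def, Complex.conj_ofReal, Matrix.sub_mul, Matrix.one_mul, Matrix.mul_sub,
    Matrix.mul_one, Matrix.smul_mul, Matrix.mul_smul, hPP, smul_smul, smul_smul]
  have hc : ((1 / (1 - s) : ℝ) : ℂ) * (((1 / (1 - s) : ℝ) : ℂ) * ((2 * (1 - s) : ℝ) : ℂ)) =
      ((1 / (1 - s) : ℝ) : ℂ) + ((1 / (1 - s) : ℝ) : ℂ) := by
    norm_cast
    field_simp
    norm_num
  rw [mul_assoc, hc, add_smul]
  abel

theorem ghzReflection_mulVec_ket (α : ℝ) (b : Fin N → Fin 2) :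
    (ghzReflection N α).mulVec (ket b) = ket b - (((1 / (1 - 1 / √2) : ℝ) : ℂ) *
      star ((ket (fun _ => 0) - ghz N α : (Fin N → Fin 2) → ℂ) b)) • (ket (fun _ => 0) - ghz N α) := by
  rw [ghzReflection, Matrix.sub_mulVec, Matrix.one_mulVec, Matrix.smul_mulVec, proj,
    Matrix.vecMulVec_mulVec, star_dotProduct_ket, mul_smul, op_smul_eq_smul]

theorem ghzReflection_mulVec_zeros (hN : 4 ≤ N) (α : ℝ) :
    (ghzReflection N α).mulVec (ket fun _ => 0) = ghz N α := by
  rw [ghzReflection_mulVec_ket, Pi.sub_apply, ghz_apply]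
  have hlt := one_div_sqrt_two_lt_one
  have h : ((1 / (1 - 1 / √2) : ℝ) : ℂ) * ((1 - 1 / √2 : ℝ) : ℂ) = 1 := by
    norm_cast
    exact one_div_mul_cancel (by linarith)
  have h' : star ((ket (fun _ : Fin N => 0) : _ → ℂ) (fun _ => 0) - ((1 / √2 : ℝ) : ℂ) *
      ((if (fun _ : Fin N => (0 : Fin 2)) = fun _ => 0 then 1 else 0) +
      Complex.exp (α * Complex.I) *
        (if (fun _ : Fin N => (0 : Fin 2)) = fun _ => 1 then 1 else 0))) =
      ((1 - 1 / √2 : ℝ) : ℂ) := by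
    rw [if_pos rfl, if_neg (zeros_ne_ones hN), mul_zero, add_zero, mul_one, star_sub,
      RCLike.star_def, Complex.conj_ofReal]
    simp [ket]
  rw [h', h, one_smul]
  abel

theorem ghzReflection_mulVec_of_ne {b : Fin N → Fin 2} (h0 : b ≠ fun _ => 0)
    (h1 : b ≠ fun _ => 1) (α : ℝ) :
    (ghzReflection N α).mulVec (ket b) = ket b := by
  rw [ghzReflection_mulVec_ket, Pi.sub_apply, ghz_apply, if_neg h0, if_neg h1]
  simp [ket, h0]

/-- The weight at `1…1` is `0`, so the image of that basis vector never matters. -/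
theorem spectralOp_ghzReflection (hN : 4 ≤ N) (α A C : ℝ) :
    spectralOp (ghzReflection N α) (durWeights N A 0 C) =
      (A : ℂ) • proj (ghz N α) + (C : ℂ) • ∑ k : Fin N, (proj (uVec k) + proj (vVec k)) := by
  have hu : ∀ k : Fin N, (ghzReflection N α).mulVec (uVec k) = uVec k := fun k =>
    ghzReflection_mulVec_of_ne (uBits_ne_zero k) (uBits_ne_one hN k) α
  have hv : ∀ k : Fin N, (ghzReflection N α).mulVec (vVec k) = vVec k := fun k =>
    ghzReflection_mulVec_of_ne (vBits_ne_zero hN k) (vBits_ne_one k) α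
  rw [spectralOp, diagonal_durWeights]
  simp only [Complex.ofReal_zero, zero_smul, add_zero, Matrix.mul_add, Matrix.add_mul,
    Matrix.mul_smul, Matrix.smul_mul, Matrix.mul_sum, Matrix.sum_mul, mul_proj_mul_conjTranspose,
    ghzReflection_mulVec_zeros hN, hu, hv]

theorem durState_eq_spectralOp (hN : 4 ≤ N) (α x : ℝ) :
    durState N α x =
      spectralOp (ghzReflection N α) (durWeights N x 0 ((1 - x) / (2 * N))) := by
  rw [spectralOp_ghzReflection hN, durState]

theorem durState_apply_self (hN : 4 ≤ N) (α x : ℝ) (a : Fin N → Fin 2) :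
    durState N α x a a = (durWeights N (x / 2) (x / 2) ((1 - x) / (2 * N)) a : ℂ) := by
  have h := congrFun (congrFun (diagonal_durWeights (N := N) 0 0 ((1 - x) / (2 * N))) a) a
  simp only [Complex.ofReal_zero, zero_smul, zero_add, Matrix.diagonal_apply_eq] at h
  rw [durState, Matrix.add_apply, ← h, Matrix.smul_apply, proj_ghz_apply_self hN, smul_eq_mul,
    ← Complex.ofReal_mul, ← Complex.ofReal_add]
  congr 1
  unfold durWeights
  ring

theorem sum_durWeights (A B C : ℝ) : ∑ a, durWeights N A B C a = A + B + C * (2 * N) := by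
  have := sum_durWeights_mul (N := N) A B C fun _ => 1
  simp only [mul_one, Finset.sum_const, Finset.card_univ, Fintype.card_fin, nsmul_eq_mul] at this
  rw [this]; ring

theorem sum_durWeights_durState (hN : 4 ≤ N) (x : ℝ) :
    ∑ a, durWeights N x 0 ((1 - x) / (2 * N)) a = 1 := by
  have : (N : ℝ) ≠ 0 := by positivity
  rw [sum_durWeights]
  field_simp
  ring

theorem isState_durState (hN : 4 ≤ N) (α : ℝ) {x : ℝ} (hx0 : 0 ≤ x) (hx1 : x ≤ 1) :
    IsState (durState N α x) := by
  rw [durState_eq_spectralOp hN]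
  refine ⟨posSemidef_spectralOp _ (durWeights_nonneg hx0 le_rfl
    (div_nonneg (by linarith) (by positivity))), ?_⟩
  rw [trace_spectralOp (conjTranspose_ghzReflection_mul_self hN α), sum_durWeights_durState hN,
    Complex.ofReal_one]

/-! ### The geometric measure of Dür's states -/

theorem exists_durState_apply_self_eq_max (hN : 4 ≤ N) (α x : ℝ) :
    ∃ a, durState N α x a a = ((max (x / 2) ((1 - x) / (2 * N)) : ℝ) : ℂ) := by
  rcases max_choice (x / 2) ((1 - x) / (2 * N)) with h | h
  · exact ⟨fun _ => 0, by rw [durState_apply_self hN, durWeights_zeros hN, h]⟩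
  · exact ⟨uBits ⟨0, by omega⟩, by rw [durState_apply_self hN, durWeights_uBits hN, h]⟩

theorem max_durState_pos (hN : 4 ≤ N) {x : ℝ} (hx0 : 0 ≤ x) :
    0 < max (x / 2) ((1 - x) / (2 * (N : ℝ))) := by
  rcases hx0.eq_or_lt with h | h
  · refine lt_max_of_lt_right ?_
    have : (0 : ℝ) < N := by positivity
    rw [← h]; positivity
  · exact lt_max_of_lt_left (by positivity)

theorem productBound_tensorPow_durState (hN : 4 ≤ N) (α : ℝ) {x : ℝ} (hx0 : 0 ≤ x)
    (hx1 : x ≤ 1) (n : ℕ) : ProductBound (tensorPow (durState N α x) n)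
      (max (x / 2) ((1 - x) / (2 * N)) ^ n) :=
  (absProductBound_durState hN α hx0 hx1 (le_max_left _ _)
    (le_max_right _ _)).productBound_tensorPow (max_durState_pos hN hx0).le
      (isState_durState hN α hx0 hx1) n

theorem lambdaSq_durState (hN : 4 ≤ N) (α : ℝ) {x : ℝ} (hx0 : 0 ≤ x) (hx1 : x ≤ 1) :
    lambdaSq (durState N α x) = max (x / 2) ((1 - x) / (2 * N)) := by
  obtain ⟨a, ha⟩ := exists_durState_apply_self_eq_max hN α x
  exact lambdaSq_eq (absProductBound_durState hN α hx0 hx1 (le_max_left _ _)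
    (le_max_right _ _)).productBound ha

theorem lambdaSq_tensorPow_durState (hN : 4 ≤ N) (α : ℝ) {x : ℝ} (hx0 : 0 ≤ x) (hx1 : x ≤ 1)
    (n : ℕ) :
    lambdaSq (tensorPow (durState N α x) n) = max (x / 2) ((1 - x) / (2 * N)) ^ n := by
  obtain ⟨a, ha⟩ := exists_durState_apply_self_eq_max hN α x
  refine lambdaSq_eq (productBound_tensorPow_durState hN α hx0 hx1 n) (a := fun j _ => a j) ?_
  simp only [tensorPow, Matrix.of_apply, ha, Finset.prod_const, Finset.card_univ,
    Fintype.card_fin, Complex.ofReal_pow]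

theorem isStrongAdditive_GM_durState (hN : 4 ≤ N) (α : ℝ) {x : ℝ} (hx0 : 0 ≤ x)
    (hx1 : x ≤ 1) : IsStrongAdditive (GM N) (durState N α x) := by
  intro κ _ _ σ hσ
  obtain ⟨a, ha⟩ := exists_durState_apply_self_eq_max hN α x
  have hm := max_durState_pos hN hx0
  have h := lambdaSq_tensor hm (absProductBound_durState hN α hx0 hx1 (le_max_left _ _)
    (le_max_right _ _)) ha hσ
  have hpos := hσ.lambdaSq_pos
  have hρ := lambdaSq_durState hN α hx0 hx1
  rw [GM_eq (by rw [h]; positivity), GM_eq (by rw [hρ]; positivity), GM_eq hpos.le, h, hρ,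
    Real.logb_mul hm.ne' hpos.ne', ← EReal.coe_add]
  congr 1
  ring

theorem GM_durState (hN : 4 ≤ N) (α : ℝ) {x : ℝ} (hx0 : 0 ≤ x) (hx1 : x ≤ 1) :
    GM N _ (durState N α x) =
      ((-Real.logb 2 (max (x / 2) ((1 - x) / (2 * N))) : ℝ) : EReal) := by
  have hm := max_durState_pos hN hx0
  rw [GM_eq (by rw [lambdaSq_durState hN α hx0 hx1]; positivity),
    lambdaSq_durState hN α hx0 hx1]

theorem hasRegularization_GM_durState (hN : 4 ≤ N) (α : ℝ) {x : ℝ} (hx0 : 0 ≤ x)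
    (hx1 : x ≤ 1) : HasRegularization (GM N) (durState N α x)
      ((-Real.logb 2 (max (x / 2) ((1 - x) / (2 * N))) : ℝ) : EReal) := by
  have hm := max_durState_pos hN hx0
  refine hasRegularization_of_eq_mul fun n => ?_
  rw [GM_eq (by rw [lambdaSq_tensorPow_durState hN α hx0 hx1]; positivity),
    lambdaSq_tensorPow_durState hN α hx0 hx1, Real.logb_pow, mul_neg]

/-! ### The relative entropy of entanglement of Dür's states -/

/-- At `x₀ = 1/(N+1)` the two candidates `x/2` and `(1-x)/(2N)` for the maximal overlap coincide,
and the witness is `2(N+1)` times that state, so its overlap bound is exactly `1`. -/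
theorem productBound_tensorPow_witness (hN : 4 ≤ N) (α : ℝ) (n : ℕ) :
    ProductBound (tensorPow (spectralOp (ghzReflection N α) (durWeights N 2 0 1)) n) 1 := by
  have hN0 : (0 : ℝ) < N := by positivity
  have hN1 : (0 : ℝ) < 2 * (N + 1) := by positivity
  set x₀ : ℝ := 1 / ((N : ℝ) + 1) with hx₀
  have h0 : 0 ≤ x₀ := by positivity
  have h1 : x₀ ≤ 1 := by
    rw [hx₀, div_le_one (by positivity)]; linarith
  have hy : (1 - x₀) / (2 * N) = x₀ / 2 := by
    rw [hx₀]; field_simp; ring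
  have hΓ : spectralOp (ghzReflection N α) (durWeights N 2 0 1) =
      ((2 * (N + 1) : ℝ) : ℂ) • durState N α x₀ := by
    rw [spectralOp_ghzReflection hN, durState, hy, smul_add, smul_smul, smul_smul,
      ← Complex.ofReal_mul, ← Complex.ofReal_mul]
    have e1 : 2 * ((N : ℝ) + 1) * x₀ = 2 := by rw [hx₀]; field_simp
    have e2 : 2 * ((N : ℝ) + 1) * (x₀ / 2) = 1 := by rw [hx₀]; field_simp
    rw [e1, e2]
  have hb := productBound_tensorPow_durState hN α h0 h1 n
  rw [hy, max_self] at hb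
  intro ψ hψ
  have h := hb ψ hψ
  rw [hΓ, tensorPow_smul, Matrix.smul_mulVec, dotProduct_smul, smul_eq_mul,
    ← Complex.ofReal_pow, Complex.re_ofReal_mul]
  calc _ ≤ (2 * ((N : ℝ) + 1)) ^ n * (x₀ / 2) ^ n :=
        mul_le_mul_of_nonneg_left h (by positivity)
    _ = 1 := by
        rw [← mul_pow, hx₀]
        field_simp
        exact one_pow n

theorem durWeights_witness_ne_zero (hN : 4 ≤ N) {A C : ℝ} {a : Fin N → Fin 2}
    (h : durWeights N A 0 C a ≠ 0) : durWeights N 2 0 1 a ≠ 0 := by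
  rcases durWeights_support a with h' | h' | ⟨k, h'⟩ | ⟨k, h'⟩ | h'
  · rw [h', durWeights_zeros hN]; norm_num
  · rw [h', durWeights_ones hN] at h; exact absurd rfl h
  · rw [h', durWeights_uBits hN]; norm_num
  · rw [h', durWeights_vBits hN]; norm_num
  · exact absurd (h' _ _ _) h

/-- The witness has eigenvalue `2` on the GHZ vector and `1` on the `u_k`, `v_k`; only the GHZ
weight contributes. -/
theorem sum_durWeights_mul_logb_witness (hN : 4 ≤ N) (x C : ℝ) :
    ∑ a, durWeights N x 0 C a * Real.logb 2 (durWeights N 2 0 1 a) = x := by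
  rw [sum_durWeights_mul]
  simp [durWeights_zeros hN, durWeights_uBits hN, durWeights_vBits hN]

/-- Halving the eigenvalue `x` into two equal parts costs one bit with weight `x`; the terms in `C`
cancel. -/
theorem sum_durWeights_mul_logb_sub (hN : 4 ≤ N) (x C : ℝ) :
    ∑ a, durWeights N x 0 C a * Real.logb 2 (durWeights N x 0 C a) -
      ∑ a, durWeights N (x / 2) (x / 2) C a *
        Real.logb 2 (durWeights N (x / 2) (x / 2) C a) = x := by
  simp only [sum_durWeights_mul, durWeights_zeros hN, durWeights_ones hN, durWeights_uBits hN,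
    durWeights_vBits hN]
  by_cases hx : x = 0
  · simp [hx]
  · rw [Real.logb_div hx two_ne_zero, Real.logb_self_eq_one (by norm_num)]
    ring

theorem REE_tensorPow_durState (hN : 4 ≤ N) (α : ℝ) {x : ℝ} (hx0 : 0 ≤ x) (hx1 : x ≤ 1)
    (n : ℕ) : REE N _ (tensorPow (durState N α x) n) = ((n * x : ℝ) : EReal) := by
  have hδ := durState_apply_self hN α x
  rw [durState_eq_spectralOp hN] at hδ ⊢
  exact REE_tensorPow_spectralOp_eq (conjTranspose_ghzReflection_mul_self hN α)
    (durWeights_nonneg hx0 le_rfl (div_nonneg (by linarith) (by positivity)))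
    (sum_durWeights_durState hN x) (durWeights_nonneg (by norm_num) le_rfl (by norm_num))
    (fun _ => durWeights_witness_ne_zero hN) (productBound_tensorPow_witness hN α n) hδ
    (sum_durWeights_mul_logb_witness hN x _) (sum_durWeights_mul_logb_sub hN x _)

theorem REE_durState (hN : 4 ≤ N) (α : ℝ) {x : ℝ} (hx0 : 0 ≤ x) (hx1 : x ≤ 1) :
    REE N _ (durState N α x) = (x : EReal) := by
  have hδ := durState_apply_self hN α x
  -- The single-copy bound is the first-power bound, with `Fin 1 → Fin 2` identified with `Fin 2`.
  have hb : ProductBound (spectralOp (ghzReflection N α) (durWeights N 2 0 1)) 1 := by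
    have h := (productBound_tensorPow_witness hN α 1).submatrix
      fun _ => (Equiv.funUnique (Fin 1) (Fin 2)).symm
    convert h using 1
    ext a b
    simp [tensorPow]
  rw [durState_eq_spectralOp hN] at hδ ⊢
  exact REE_spectralOp_eq (conjTranspose_ghzReflection_mul_self hN α)
    (durWeights_nonneg hx0 le_rfl (div_nonneg (by linarith) (by positivity)))
    (sum_durWeights_durState hN x) (durWeights_nonneg (by norm_num) le_rfl (by norm_num))
    (fun _ => durWeights_witness_ne_zero hN) hb hδ
    (sum_durWeights_mul_logb_witness hN x _) (sum_durWeights_mul_logb_sub hN x _)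

theorem hasRegularization_REE_durState (hN : 4 ≤ N) (α : ℝ) {x : ℝ} (hx0 : 0 ≤ x)
    (hx1 : x ≤ 1) : HasRegularization (REE N) (durState N α x) (x : EReal) :=
  hasRegularization_of_eq_mul (REE_tensorPow_durState hN α hx0 hx1)

end Dur

end MultipartiteEntanglement

theorem mainTheorem11 (N : ℕ) (hN : 4 ≤ N) (α x : ℝ) (hx0 : 0 ≤ x) (hx1 : x ≤ 1) :
    MultipartiteEntanglement.IsStrongAdditive (MultipartiteEntanglement.GM N)
        (MultipartiteEntanglement.durState N α x) ∧
      (x ≤ 1 / ((N : ℝ) + 1) →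
        MultipartiteEntanglement.GM N _ (MultipartiteEntanglement.durState N α x) =
            ((-Real.logb 2 ((1 - x) / (2 * (N : ℝ))) : ℝ) : EReal) ∧
          MultipartiteEntanglement.HasRegularization (MultipartiteEntanglement.GM N)
            (MultipartiteEntanglement.durState N α x)
            ((-Real.logb 2 ((1 - x) / (2 * (N : ℝ))) : ℝ) : EReal)) ∧
      (1 / ((N : ℝ) + 1) ≤ x →
        MultipartiteEntanglement.GM N _ (MultipartiteEntanglement.durState N α x) =
            ((-Real.logb 2 (x / 2) : ℝ) : EReal) ∧
          MultipartiteEntanglement.HasRegularization (MultipartiteEntanglement.GM N)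
            (MultipartiteEntanglement.durState N α x)
            ((-Real.logb 2 (x / 2) : ℝ) : EReal)) ∧
      MultipartiteEntanglement.IsAdditive (MultipartiteEntanglement.REE N)
        (MultipartiteEntanglement.durState N α x) ∧
      MultipartiteEntanglement.REE N _ (MultipartiteEntanglement.durState N α x) =
        (x : EReal) ∧
      MultipartiteEntanglement.HasRegularization (MultipartiteEntanglement.REE N)
        (MultipartiteEntanglement.durState N α x) (x : EReal) := by
  open MultipartiteEntanglement in
  have hN0 : (0 : ℝ) < N := by positivity
  have hG := GM_durState hN α hx0 hx1
  have hG' := hasRegularization_GM_durState hN α hx0 hx1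
  have hR := REE_durState hN α hx0 hx1
  have hR' := hasRegularization_REE_durState hN α hx0 hx1
  refine ⟨isStrongAdditive_GM_durState hN α hx0 hx1, fun h => ?_, fun h => ?_, ?_, hR, hR'⟩
  · rw [le_div_iff₀ (by positivity)] at h
    have : max (x / 2) ((1 - x) / (2 * (N : ℝ))) = (1 - x) / (2 * N) := by
      rw [max_eq_right_iff, div_le_div_iff₀ (by positivity) (by positivity)]
      linarith
    rw [this] at hG hG'
    exact ⟨hG, hG'⟩
  · rw [div_le_iff₀ (by positivity)] at h
    have : max (x / 2) ((1 - x) / (2 * (N : ℝ))) = x / 2 := by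
      rw [max_eq_left_iff, div_le_div_iff₀ (by positivity) (by positivity)]
      linarith
    rw [this] at hG hG'
    exact ⟨hG, hG'⟩
  · rw [IsAdditive, hR]
    exact hR'
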